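/- For a complex Banach space $X$, a set $J\subseteq\mathbb{R}$ and $s\in[1,\infty)$, let $V^s(J;X)$ be the space of all functions $f\colon J\to X$ with $$\|f\|_{V^s(J;X)}:=\sup_{t\in J}\|f(t)\|_X+\sup_{t_0<\dots<t_N,\ t_i\in J}\Bigl(\sum_{i=0}^{N-1}\|f(t_{i+1})-f(t_i)\|_X^s\Bigr)^{1/s}<\infty,$$ and let $V^\infty(J;X):=L^\infty(J;X)$ be the space of all bounded strongly measurable functions $f\colon J\to X$ (functions are not identified almost everywhere) with the supremum norm. Let $X_0,X_1$ be complex Banach spaces which are continuously embedded in a common Hausdorff topological vector space $V$; then $V^{s_0}(J;X_0)$ and $V^{s_1}(J;X_1)$ are continuously embedded in the space of all functions $J\to V$ with the topology of pointwise convergence. For $\theta\in[0,1]$ let $[X_0,X_1]_\theta$ be the complex interpolation space: the space of all $x=f(\theta)$, where $f$ is bounded and continuous on the strip $\{0\le\operatorname{Re}z\le1\}$ with values in $X_0+X_1$, holomorphic in its interior, and for $j=0,1$ the function $t\mapsto f(j+it)$ is continuous from $\mathbb{R}$ to $X_j$ and tends to $0$ in $X_j$ as $|t|\to\infty$; its norm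 is the infimum of $\max_{j=0,1}\sup_{t\in\mathbb{R}}\|f(j+it)\|_{X_j}$ over all such $f$. Let $J\subseteq\mathbb{R}$, $\theta\in[0,1]$, $s_0,s_1\in[1,\infty]$ and set $\frac1{s_\theta}=\frac{1-\theta}{s_0}+\frac{\theta}{s_1}$. Then $$[V^{s_0}(J;X_0),V^{s_1}(J;X_1)]_\theta\hookrightarrow V^{s_\theta}(J;[X_0,X_1]_\theta)$$ continuously, i.e. there is a constant $C\ge 0$, depending only on $s_0,s_1,\theta$, such that every $f\in[V^{s_0}(J;X_0),V^{s_1}(J;X_1)]_\theta$ takes values in $[X_0,X_1]_\theta$, belongs to $V^{s_\theta}(J;[X_0,X_1]_\theta)$ and satisfies $$\|f\|_{V^{s_\theta}(J;[X_0,X_1]_\theta)}\le C\,\|f\|_{[V^{s_0}(J;X_0),V^{s_1}(J;X_1)]_\theta}.$$ -/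

import Mathlib

open scoped ENNReal

universe u₀ u₁ v

namespace VarInterp

/-! ## Functions of bounded `s`-variation -/

section Variation

variable {J : Set ℝ} {X : Type*} [NormedAddCommGroup X]

/-- The `s`-variation `[f]_{V^s(J;X)}`: the supremum of
`(∑_{i<N} ‖f(t_{i+1}) - f(t_i)‖^s)^{1/s}` over all finite sequences `t_0 < ⋯ < t_N` in `J`. -/
noncomputable def eVar (s : ℝ) (f : J → X) : ℝ≥0∞ :=
  ⨆ (N : ℕ) (t : Fin (N + 1) → J) (_ : StrictMono t),
    (∑ i : Fin N, ‖f (t i.succ) - f (t i.castSucc)‖ₑ ^ s) ^ (1 / s)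

/-- The norm of `V^s(J;X)` as an extended real: `sup_J ‖f‖ + [f]_{V^s(J;X)}` for `s < ∞`
and `sup_J ‖f‖` for `s = ∞`. -/
noncomputable def eVarNorm (s : ℝ≥0∞) (f : J → X) : ℝ≥0∞ :=
  (⨆ t, ‖f t‖ₑ) + (if s = ∞ then 0 else eVar s.toReal f)

/-- `f ∈ V^s(J;X)`. For `s < ∞` this says that `f` is bounded and of bounded `s`-variation, and
`V^∞(J;X) = L^∞(J;X)` is the space of bounded strongly measurable functions. -/
def MemVar (s : ℝ≥0∞) (f : J → X) : Prop :=
  (s = ∞ → MeasureTheory.StronglyMeasurable f) ∧ eVarNorm s f < ∞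

theorem enorm_le_eVarNorm (s : ℝ≥0∞) (f : J → X) (t : J) : ‖f t‖ₑ ≤ eVarNorm s f :=
  (le_iSup (fun t => ‖f t‖ₑ) t).trans le_self_add

theorem eVar_add_le {s : ℝ} (hs : 1 ≤ s) (f g : J → X) :
    eVar s (f + g) ≤ eVar s f + eVar s g := by
  refine iSup_le fun N => iSup_le fun t => iSup_le fun ht => ?_
  have h1 : ∀ h : J → X,
      (∑ i : Fin N, ‖h (t i.succ) - h (t i.castSucc)‖ₑ ^ s) ^ (1 / s) ≤ eVar s h := fun h =>
    le_iSup_of_le N (le_iSup_of_le t (le_iSup_of_le ht le_rfl))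
  refine le_trans ?_ (add_le_add (h1 f) (h1 g))
  refine le_trans ?_ (ENNReal.Lp_add_le _ _ _ hs)
  gcongr with i
  simp only [Pi.add_apply]
  rw [add_sub_add_comm]
  exact enorm_add_le _ _

theorem eVarNorm_add_le {s : ℝ≥0∞} (hs : 1 ≤ s) (f g : J → X) :
    eVarNorm s (f + g) ≤ eVarNorm s f + eVarNorm s g := by
  unfold eVarNorm
  rw [add_add_add_comm]
  refine add_le_add (iSup_le fun t => (enorm_add_le _ _).trans
    (add_le_add (le_iSup (fun t => ‖f t‖ₑ) t) (le_iSup (fun t => ‖g t‖ₑ) t))) ?_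
  split_ifs with h
  · simp
  · exact eVar_add_le ((ENNReal.ofReal_le_iff_le_toReal h).1 (by simpa using hs)) f g

variable [NormedSpace ℂ X]

theorem eVar_smul {s : ℝ} (hs : 0 < s) (c : ℂ) (f : J → X) :
    eVar s (c • f) = ‖c‖ₑ * eVar s f := by
  unfold eVar
  simp only [ENNReal.mul_iSup, Pi.smul_apply, ← smul_sub, enorm_smul,
    ENNReal.mul_rpow_of_nonneg _ _ hs.le, ← Finset.mul_sum,
    ENNReal.mul_rpow_of_nonneg _ _ (one_div_pos.2 hs).le, ← ENNReal.rpow_mul,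
    mul_one_div_cancel hs.ne', ENNReal.rpow_one]

theorem eVarNorm_smul {s : ℝ≥0∞} (hs : 1 ≤ s) (c : ℂ) (f : J → X) :
    eVarNorm s (c • f) = ‖c‖ₑ * eVarNorm s f := by
  unfold eVarNorm
  rw [mul_add, ENNReal.mul_iSup]
  congr 1
  · simp only [Pi.smul_apply, enorm_smul]
  · split_ifs with h
    · simp
    · exact eVar_smul (ENNReal.toReal_pos (zero_lt_one.trans_le hs).ne' h) c f

end Variation

section VSpace

variable (s : ℝ≥0∞) [hs : Fact (1 ≤ s)] (J : Set ℝ) (X : Type*) [NormedAddCommGroup X]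
  [NormedSpace ℂ X]

/-- `V^s(J;X)` as a linear subspace of all functions `J → X`. -/
def varSubmodule : Submodule ℂ (J → X) where
  carrier := {f | MemVar s f}
  zero_mem' := by
    refine ⟨fun _ => MeasureTheory.stronglyMeasurable_zero, ?_⟩
    have h := eVarNorm_smul hs.out (0 : ℂ) (0 : J → X)
    rw [zero_smul] at h
    rw [h]
    simp
  add_mem' := fun {f g} hf hg =>
    ⟨fun h => (hf.1 h).add (hg.1 h),
      (eVarNorm_add_le hs.out f g).trans_lt (ENNReal.add_lt_top.2 ⟨hf.2, hg.2⟩)⟩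
  smul_mem' := fun c {f} hf =>
    ⟨fun h => (hf.1 h).const_smul c, by
      rw [eVarNorm_smul hs.out]
      exact ENNReal.mul_lt_top enorm_lt_top hf.2⟩

/-- The normed space `V^s(J;X)`, with norm `‖f‖_{V^s(J;X)}` (and not with the topology of
pointwise convergence). -/
def VSpace : Type _ := varSubmodule s J X

noncomputable instance : AddCommGroup (VSpace s J X) :=
  inferInstanceAs (AddCommGroup (varSubmodule s J X))

noncomputable instance : Module ℂ (VSpace s J X) :=
  inferInstanceAs (Module ℂ (varSubmodule s J X))

variable {s J X} in
/-- The function underlying an element of `V^s(J;X)`. -/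
def VSpace.toFun (f : VSpace s J X) : J → X := f.1

noncomputable instance : Norm (VSpace s J X) := ⟨fun f => (eVarNorm s f.toFun).toReal⟩

theorem VSpace.core : NormedSpace.Core ℂ (VSpace s J X) where
  norm_nonneg _ := ENNReal.toReal_nonneg
  norm_smul c f := by
    change (eVarNorm s (c • f.toFun)).toReal = ‖c‖ * (eVarNorm s f.toFun).toReal
    rw [eVarNorm_smul hs.out, ENNReal.toReal_mul, toReal_enorm]
  norm_triangle f g := by
    change (eVarNorm s (f.toFun + g.toFun)).toReal ≤ _
    have hf : eVarNorm s f.toFun ≠ ∞ := f.2.2.ne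
    have hg : eVarNorm s g.toFun ≠ ∞ := g.2.2.ne
    refine (ENNReal.toReal_mono (ENNReal.add_ne_top.2 ⟨hf, hg⟩)
      (eVarNorm_add_le hs.out f.toFun g.toFun)).trans ?_
    rw [ENNReal.toReal_add hf hg]
    exact le_rfl
  norm_eq_zero_iff f := by
    constructor
    · intro h
      have h0 : eVarNorm s f.toFun = 0 :=
        ((ENNReal.toReal_eq_zero_iff _).1 h).resolve_right f.2.2.ne
      refine Subtype.ext (funext fun t => ?_)
      have h1 := enorm_le_eVarNorm s f.toFun t
      rw [h0] at h1
      exact enorm_eq_zero.1 (le_antisymm h1 zero_le)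
    · rintro rfl
      have h := eVarNorm_smul hs.out (0 : ℂ) (0 : J → X)
      rw [zero_smul, enorm_zero, zero_mul] at h
      change (eVarNorm s (0 : J → X)).toReal = 0
      rw [h, ENNReal.toReal_zero]

noncomputable instance : NormedAddCommGroup (VSpace s J X) :=
  NormedAddCommGroup.ofCore (VSpace.core s J X)

noncomputable instance : NormedSpace ℂ (VSpace s J X) :=
  NormedSpace.ofCore (VSpace.core s J X)

/-- Evaluation at `t ∈ J`, a bounded linear map `V^s(J;X) → X`. -/
noncomputable def VSpace.eval (t : J) : VSpace s J X →L[ℂ] X :=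
  LinearMap.mkContinuous
    { toFun := fun f => f.toFun t
      map_add' := fun _ _ => rfl
      map_smul' := fun _ _ => rfl } 1 (fun f => by
    rw [one_mul, ← toReal_enorm]
    exact ENNReal.toReal_mono f.2.2.ne (enorm_le_eVarNorm s f.toFun t))

variable {X} {V : Type*} [AddCommGroup V] [Module ℂ V] [TopologicalSpace V]

/-- If `X` is a subspace of `V` via `ι`, then `V^s(J;X)` is a subspace of the topological vector
space of all functions `J → V` (with pointwise convergence) via `f ↦ ι ∘ f`. -/
noncomputable def VSpace.incl (ι : X →L[ℂ] V) : VSpace s J X →L[ℂ] (J → V) :=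
  ContinuousLinearMap.pi fun t => ι.comp (VSpace.eval s J X t)

end VSpace

/-! ## Complex interpolation

A couple of Banach spaces `X₀, X₁` is given by continuous linear inclusions `ι₀ : X₀ → V` and
`ι₁ : X₁ → V` into a Hausdorff topological vector space `V`. -/

section Couple

variable {X₀ X₁ V : Type*} [NormedAddCommGroup X₀] [NormedSpace ℂ X₀]
  [NormedAddCommGroup X₁] [NormedSpace ℂ X₁]
  [AddCommGroup V] [Module ℂ V] [TopologicalSpace V] [IsTopologicalAddGroup V] [T2Space V]
  (ι₀ : X₀ →L[ℂ] V) (ι₁ : X₁ →L[ℂ] V)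

/-- The map `(x₀, x₁) ↦ x₀ + x₁` into `V`, on the product with the norm `‖x₀‖ + ‖x₁‖`. -/
noncomputable def addMap : WithLp 1 (X₀ × X₁) →L[ℂ] V :=
  ι₀.comp (WithLp.fstL 1 ℂ X₀ X₁) + ι₁.comp (WithLp.sndL 1 ℂ X₀ X₁)

/-- The sum `X₀ + X₁` with the norm `‖x‖ = inf {‖x₀‖ + ‖x₁‖ : x = x₀ + x₁}`, realized as the
quotient of `X₀ × X₁` by the pairs whose sum in `V` vanishes. -/
def SumSpace : Type _ := WithLp 1 (X₀ × X₁) ⧸ (addMap ι₀ ι₁).ker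

noncomputable instance : NormedAddCommGroup (SumSpace ι₀ ι₁) :=
  haveI : IsClosed ((addMap ι₀ ι₁).ker : Set (WithLp 1 (X₀ × X₁))) :=
    (addMap ι₀ ι₁).isClosed_ker
  inferInstanceAs (NormedAddCommGroup (WithLp 1 (X₀ × X₁) ⧸ (addMap ι₀ ι₁).ker))

noncomputable instance : NormedSpace ℂ (SumSpace ι₀ ι₁) :=
  inferInstanceAs (NormedSpace ℂ (WithLp 1 (X₀ × X₁) ⧸ (addMap ι₀ ι₁).ker))

/-- The inclusion `X₀ + X₁ → V`. -/
noncomputable def SumSpace.incl : SumSpace ι₀ ι₁ →ₗ[ℂ] V :=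
  (addMap ι₀ ι₁).ker.liftQ (addMap ι₀ ι₁).toLinearMap le_rfl

/-- The inclusion `X₀ → X₀ + X₁`. -/
noncomputable def SumSpace.inl : X₀ →ₗ[ℂ] SumSpace ι₀ ι₁ where
  toFun x := Submodule.Quotient.mk (WithLp.toLp 1 (x, 0))
  map_add' x y := by
    refine (congrArg Submodule.Quotient.mk ?_).trans (Submodule.Quotient.mk_add _)
    rw [← WithLp.toLp_add, Prod.mk_add_mk, add_zero]
  map_smul' c x := by
    refine (congrArg Submodule.Quotient.mk ?_).trans (Submodule.Quotient.mk_smul _ c _)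
    rw [← WithLp.toLp_smul, Prod.smul_mk, smul_zero]

/-- The inclusion `X₁ → X₀ + X₁`. -/
noncomputable def SumSpace.inr : X₁ →ₗ[ℂ] SumSpace ι₀ ι₁ where
  toFun x := Submodule.Quotient.mk (WithLp.toLp 1 (0, x))
  map_add' x y := by
    refine (congrArg Submodule.Quotient.mk ?_).trans (Submodule.Quotient.mk_add _)
    rw [← WithLp.toLp_add, Prod.mk_add_mk, add_zero]
  map_smul' c x := by
    refine (congrArg Submodule.Quotient.mk ?_).trans (Submodule.Quotient.mk_smul _ c _)
    rw [← WithLp.toLp_smul, Prod.smul_mk, smul_zero]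

theorem SumSpace.incl_inl (x : X₀) : SumSpace.incl ι₀ ι₁ (SumSpace.inl ι₀ ι₁ x) = ι₀ x := by
  change addMap ι₀ ι₁ (WithLp.toLp 1 (x, 0)) = ι₀ x
  simp [addMap]

theorem SumSpace.incl_inr (x : X₁) : SumSpace.incl ι₀ ι₁ (SumSpace.inr ι₀ ι₁ x) = ι₁ x := by
  change addMap ι₀ ι₁ (WithLp.toLp 1 (0, x)) = ι₁ x
  simp [addMap]

theorem SumSpace.norm_inl_le (x : X₀) : ‖SumSpace.inl ι₀ ι₁ x‖ ≤ ‖x‖ :=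
  (Submodule.Quotient.norm_mk_le _ _).trans_eq (by simp)

theorem SumSpace.norm_inr_le (x : X₁) : ‖SumSpace.inr ι₀ ι₁ x‖ ≤ ‖x‖ :=
  (Submodule.Quotient.norm_mk_le _ _).trans_eq (by simp)

open Complex.HadamardThreeLines in
/-- The functions of the complex method: `f` is bounded and continuous on the closed strip
`0 ≤ Re z ≤ 1` and holomorphic on the open strip, with values in `X₀ + X₁`, and its boundary
values are `f(it) = g₀(t)` and `f(1+it) = g₁(t)` with `g₀ ∈ C₀(ℝ;X₀)` and `g₁ ∈ C₀(ℝ;X₁)`. -/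
structure Admissible (f : ℂ → SumSpace ι₀ ι₁) (g₀ : ZeroAtInftyContinuousMap ℝ X₀)
    (g₁ : ZeroAtInftyContinuousMap ℝ X₁) : Prop where
  diffContOnCl : DiffContOnCl ℂ f (verticalStrip 0 1)
  bounded : ∃ M : ℝ, ∀ z ∈ verticalClosedStrip 0 1, ‖f z‖ ≤ M
  left : ∀ t : ℝ, f (t * Complex.I) = SumSpace.inl ι₀ ι₁ (g₀ t)
  right : ∀ t : ℝ, f (1 + t * Complex.I) = SumSpace.inr ι₀ ι₁ (g₁ t)

variable {ι₀ ι₁}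

theorem Admissible.zero : Admissible ι₀ ι₁ 0 0 0 where
  diffContOnCl := diffContOnCl_const
  bounded := ⟨0, fun z _ => by simp⟩
  left t := by simp
  right t := by simp

theorem Admissible.add {f f' : ℂ → SumSpace ι₀ ι₁} {g₀ g₀' g₁ g₁'}
    (h : Admissible ι₀ ι₁ f g₀ g₁) (h' : Admissible ι₀ ι₁ f' g₀' g₁') :
    Admissible ι₀ ι₁ (f + f') (g₀ + g₀') (g₁ + g₁') where
  diffContOnCl := h.diffContOnCl.add h'.diffContOnCl
  bounded := by
    obtain ⟨M, hM⟩ := h.bounded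
    obtain ⟨M', hM'⟩ := h'.bounded
    exact ⟨M + M', fun z hz => (norm_add_le _ _).trans (add_le_add (hM z hz) (hM' z hz))⟩
  left t := by simp [h.left t, h'.left t]
  right t := by simp [h.right t, h'.right t]

theorem Admissible.smul {f : ℂ → SumSpace ι₀ ι₁} {g₀ g₁} (c : ℂ)
    (h : Admissible ι₀ ι₁ f g₀ g₁) : Admissible ι₀ ι₁ (c • f) (c • g₀) (c • g₁) where
  diffContOnCl := h.diffContOnCl.const_smul c
  bounded := by
    obtain ⟨M, hM⟩ := h.bounded
    exact ⟨‖c‖ * M, fun z hz => by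
      rw [Pi.smul_apply, norm_smul]
      exact mul_le_mul_of_nonneg_left (hM z hz) (norm_nonneg c)⟩
  left t := by simp [h.left t]
  right t := by simp [h.right t]

theorem zeroAtInfty_norm_apply_le {E : Type*} [NormedAddCommGroup E]
    (g : ZeroAtInftyContinuousMap ℝ E) (t : ℝ) : ‖g t‖ ≤ ‖g‖ :=
  g.toBCF.norm_coe_le_norm t

theorem Admissible.norm_le {f : ℂ → SumSpace ι₀ ι₁} {g₀ g₁} (h : Admissible ι₀ ι₁ f g₀ g₁)
    (θ : Set.Icc (0 : ℝ) 1) : ‖f ((θ : ℝ) : ℂ)‖ ≤ max ‖g₀‖ ‖g₁‖ := by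
  obtain ⟨M, hM⟩ := h.bounded
  have h0 : 0 ≤ max ‖g₀‖ ‖g₁‖ := (norm_nonneg _).trans (le_max_left _ _)
  have key := Complex.HadamardThreeLines.norm_le_interp_of_mem_verticalClosedStrip₀₁' f
    (z := ((θ : ℝ) : ℂ)) (a := max ‖g₀‖ ‖g₁‖) (b := max ‖g₀‖ ‖g₁‖)
    (by simpa [Complex.HadamardThreeLines.verticalClosedStrip] using θ.2) h.diffContOnCl
    ⟨M, by rintro _ ⟨z, hz, rfl⟩; exact hM z hz⟩
    (fun z hz => by
      have hz' : z = (z.im : ℂ) * Complex.I := by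
        apply Complex.ext <;> simp_all
      rw [hz', h.left]
      exact ((SumSpace.norm_inl_le ι₀ ι₁ _).trans (zeroAtInfty_norm_apply_le g₀ _)).trans
        (le_max_left _ _))
    (fun z hz => by
      have hz' : z = 1 + (z.im : ℂ) * Complex.I := by
        apply Complex.ext <;> simp_all
      rw [hz', h.right]
      exact ((SumSpace.norm_inr_le ι₀ ι₁ _).trans (zeroAtInfty_norm_apply_le g₁ _)).trans
        (le_max_right _ _))
  rw [← Real.rpow_add_of_nonneg h0 (by simpa using θ.2.2) (by simpa using θ.2.1)] at key
  simpa using key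

variable (ι₀ ι₁) (θ : Set.Icc (0 : ℝ) 1)

/-- `[X₀, X₁]_θ` as a linear subspace of `X₀ + X₁`: the values `f(θ)` of admissible functions. -/
def interpSubmodule : Submodule ℂ (SumSpace ι₀ ι₁) where
  carrier := {x | ∃ f g₀ g₁, Admissible ι₀ ι₁ f g₀ g₁ ∧ f ((θ : ℝ) : ℂ) = x}
  zero_mem' := ⟨0, 0, 0, Admissible.zero, rfl⟩
  add_mem' := by
    rintro _ _ ⟨f, g₀, g₁, h, rfl⟩ ⟨f', g₀', g₁', h', rfl⟩
    exact ⟨_, _, _, h.add h', rfl⟩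
  smul_mem' := by
    rintro c _ ⟨f, g₀, g₁, h, rfl⟩
    exact ⟨_, _, _, h.smul c, rfl⟩

/-- The complex interpolation space `[X₀, X₁]_θ` with its norm (and not with that of
`X₀ + X₁`). -/
def Interp : Type _ := interpSubmodule ι₀ ι₁ θ

noncomputable instance : AddCommGroup (Interp ι₀ ι₁ θ) :=
  inferInstanceAs (AddCommGroup (interpSubmodule ι₀ ι₁ θ))

noncomputable instance : Module ℂ (Interp ι₀ ι₁ θ) :=
  inferInstanceAs (Module ℂ (interpSubmodule ι₀ ι₁ θ))

/-- The inclusion `[X₀, X₁]_θ → X₀ + X₁`. -/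
noncomputable def Interp.toSum : Interp ι₀ ι₁ θ →ₗ[ℂ] SumSpace ι₀ ι₁ :=
  (interpSubmodule ι₀ ι₁ θ).subtype

/-- The inclusion `[X₀, X₁]_θ → V`. -/
noncomputable def Interp.incl : Interp ι₀ ι₁ θ →ₗ[ℂ] V :=
  (SumSpace.incl ι₀ ι₁).comp (Interp.toSum ι₀ ι₁ θ)

/-- The norms `max (sup_t ‖f(it)‖_{X₀}) (sup_t ‖f(1+it)‖_{X₁})` of the admissible `f` with
`f(θ) = x`. -/
def interpNormSet (x : SumSpace ι₀ ι₁) : Set ℝ :=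
  {r | ∃ f g₀ g₁, Admissible ι₀ ι₁ f g₀ g₁ ∧ f ((θ : ℝ) : ℂ) = x ∧ r = max ‖g₀‖ ‖g₁‖}

noncomputable instance : Norm (Interp ι₀ ι₁ θ) :=
  ⟨fun x => sInf (interpNormSet ι₀ ι₁ θ (Interp.toSum ι₀ ι₁ θ x))⟩

theorem Interp.nonempty_normSet (x : Interp ι₀ ι₁ θ) :
    (interpNormSet ι₀ ι₁ θ (Interp.toSum ι₀ ι₁ θ x)).Nonempty := by
  obtain ⟨f, g₀, g₁, h, hx⟩ := x.2
  exact ⟨_, f, g₀, g₁, h, hx, rfl⟩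

theorem Interp.norm_toSum_le (x : Interp ι₀ ι₁ θ) : ‖Interp.toSum ι₀ ι₁ θ x‖ ≤ ‖x‖ := by
  refine le_csInf (Interp.nonempty_normSet ι₀ ι₁ θ x) ?_
  rintro _ ⟨f, g₀, g₁, h, hx, rfl⟩
  rw [← hx]
  exact h.norm_le θ

theorem Interp.norm_le {x : Interp ι₀ ι₁ θ} {f g₀ g₁} (h : Admissible ι₀ ι₁ f g₀ g₁)
    (hx : f ((θ : ℝ) : ℂ) = Interp.toSum ι₀ ι₁ θ x) : ‖x‖ ≤ max ‖g₀‖ ‖g₁‖ := by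
  refine csInf_le ⟨0, ?_⟩ ⟨f, g₀, g₁, h, hx, rfl⟩
  rintro _ ⟨f, g₀, g₁, -, -, rfl⟩
  exact (norm_nonneg _).trans (le_max_left _ _)

theorem Interp.exists_lt {x : Interp ι₀ ι₁ θ} {r : ℝ} (hr : ‖x‖ < r) :
    ∃ f g₀ g₁, Admissible ι₀ ι₁ f g₀ g₁ ∧ f ((θ : ℝ) : ℂ) = Interp.toSum ι₀ ι₁ θ x ∧
      max ‖g₀‖ ‖g₁‖ < r := by
  obtain ⟨_, ⟨f, g₀, g₁, h, hx, rfl⟩, hlt⟩ :=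
    exists_lt_of_csInf_lt (Interp.nonempty_normSet ι₀ ι₁ θ x) hr
  exact ⟨f, g₀, g₁, h, hx, hlt⟩

theorem Interp.norm_nonneg' (x : Interp ι₀ ι₁ θ) : 0 ≤ ‖x‖ :=
  (norm_nonneg _).trans (Interp.norm_toSum_le ι₀ ι₁ θ x)

theorem Interp.norm_smul_le' (c : ℂ) (x : Interp ι₀ ι₁ θ) : ‖c • x‖ ≤ ‖c‖ * ‖x‖ := by
  have key : ∀ r, ‖x‖ < r → ‖c • x‖ ≤ ‖c‖ * r := by
    intro r hr
    obtain ⟨f, g₀, g₁, h, hx, hlt⟩ := Interp.exists_lt ι₀ ι₁ θ hr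
    have h1 : (c • f) ((θ : ℝ) : ℂ) = Interp.toSum ι₀ ι₁ θ (c • x) := by
      rw [map_smul, ← hx, Pi.smul_apply]
    refine (Interp.norm_le ι₀ ι₁ θ (h.smul c) h1).trans ?_
    rw [norm_smul, norm_smul, ← mul_max_of_nonneg _ _ (norm_nonneg c)]
    exact mul_le_mul_of_nonneg_left hlt.le (norm_nonneg c)
  refine le_of_forall_pos_le_add fun ε hε => ?_
  have hpos : 0 < ‖c‖ + 1 := by positivity
  refine (key (‖x‖ + ε / (‖c‖ + 1)) (lt_add_of_pos_right _ (by positivity))).trans ?_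
  rw [mul_add]
  gcongr
  rw [mul_div_assoc', div_le_iff₀ hpos]
  nlinarith

theorem Interp.core : NormedSpace.Core ℂ (Interp ι₀ ι₁ θ) where
  norm_nonneg := Interp.norm_nonneg' ι₀ ι₁ θ
  norm_smul c x := by
    refine le_antisymm (Interp.norm_smul_le' ι₀ ι₁ θ c x) ?_
    by_cases hc : c = 0
    · rw [hc, norm_zero, zero_mul]
      exact Interp.norm_nonneg' ι₀ ι₁ θ _
    · have h := Interp.norm_smul_le' ι₀ ι₁ θ c⁻¹ (c • x)
      rw [smul_smul, inv_mul_cancel₀ hc, one_smul, norm_inv] at h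
      have hc' : 0 < ‖c‖ := norm_pos_iff.2 hc
      calc ‖c‖ * ‖x‖ ≤ ‖c‖ * (‖c‖⁻¹ * ‖c • x‖) := mul_le_mul_of_nonneg_left h hc'.le
        _ = ‖c • x‖ := by rw [← mul_assoc, mul_inv_cancel₀ hc'.ne', one_mul]
  norm_triangle x y := by
    refine le_of_forall_pos_le_add fun ε hε => ?_
    obtain ⟨f, g₀, g₁, h, hx, hlt⟩ := Interp.exists_lt ι₀ ι₁ θ
      (lt_add_of_pos_right ‖x‖ (half_pos hε))
    obtain ⟨f', g₀', g₁', h', hx', hlt'⟩ := Interp.exists_lt ι₀ ι₁ θ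
      (lt_add_of_pos_right ‖y‖ (half_pos hε))
    have h1 : (f + f') ((θ : ℝ) : ℂ) = Interp.toSum ι₀ ι₁ θ (x + y) := by
      rw [map_add, ← hx, ← hx', Pi.add_apply]
    refine (Interp.norm_le ι₀ ι₁ θ (h.add h') h1).trans ?_
    have h2 : max ‖g₀ + g₀'‖ ‖g₁ + g₁'‖ ≤ max ‖g₀‖ ‖g₁‖ + max ‖g₀'‖ ‖g₁'‖ :=
      max_le
        ((norm_add_le _ _).trans (add_le_add (le_max_left _ _) (le_max_left _ _)))
        ((norm_add_le _ _).trans (add_le_add (le_max_right _ _) (le_max_right _ _)))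
    linarith
  norm_eq_zero_iff x := by
    constructor
    · intro h
      have h1 := Interp.norm_toSum_le ι₀ ι₁ θ x
      rw [h] at h1
      exact Subtype.ext (norm_le_zero_iff.1 h1)
    · rintro rfl
      refine le_antisymm ?_ (Interp.norm_nonneg' ι₀ ι₁ θ 0)
      have h := Interp.norm_le ι₀ ι₁ θ (x := 0) Admissible.zero (by rw [map_zero, Pi.zero_apply])
      simpa using h

noncomputable instance : NormedAddCommGroup (Interp ι₀ ι₁ θ) :=
  NormedAddCommGroup.ofCore (Interp.core ι₀ ι₁ θ)

noncomputable instance : NormedSpace ℂ (Interp ι₀ ι₁ θ) :=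
  NormedSpace.ofCore (Interp.core ι₀ ι₁ θ)

end Couple

end VarInterp

open VarInterp

open VarInterp

/-! For fixed `t_0 < ⋯ < t_N`, each increment operator `w ↦ w(t_{i+1}) - w(t_i)` maps
`V^{s_j}(J;X_j)` boundedly to `X_j` and is compatible with the ambient spaces. It therefore turns an
admissible `F` with `F(θ) = f` into an admissible function for `(X₀, X₁)` whose value at `θ` is the
increment of `f`. The norms of the increments of a fixed `w` form a vector in `ℓ^{s_j}` of norm at
most `2‖w‖`.

For `0 < θ < 1` this is combined with the convexity bound that controls `‖x‖_θ` by (Poisson average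
of `‖g₀‖`)^{1-θ} (Poisson average of `‖g₁‖`)^θ. Only finite sums are used. The Poisson integral is
replaced by `ε + ∑ a_s / (z + δ - is)`, which is holomorphic with positive real part, dominates the
boundary norms up to a Gaussian (`gaussian_mul_le_cauchySum`), and has nodes and weights common to
all increments (`exists_nodes`). Dividing by `H₀^{1-z} H₁^z` gives `‖x‖ ≤ K A_i^{1-θ} B_i^θ` for the
`i`-th increment (`Admissible.norm_le_mul_rpow`). The total weight of the nodes is bounded by an
absolute constant, so the triangle inequality bounds `A` in `ℓ^{s₀}` and `B` in `ℓ^{s₁}`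
independently of `N` (`exists_majorants`). Hölder's inequality then yields the `s_θ`-variation.

At `θ = 0` or `1` the Poisson averages degenerate. A multiplier concentrating the boundary values at
one point gives `‖x‖ ≤ ‖g_j(0)‖` instead, so the increments of `f` are dominated by those of the
single function `g_j(0)`.

If `0 < θ < 1` and `s_θ = ∞`, then `s₀ = s₁ = ∞` and strong measurability is still needed. It is
equivalent to having, for every `ε`, a countable measurable partition with oscillation at most `ε`
on each piece, and such partitions pass from the boundary values to `f`. -/

namespace VarInterp

open MeasureTheory Filter Topology Complex.HadamardThreeLines

/-! ## Strong measurability via countable partitions -/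

section Measurability

variable {α E : Type*} [MeasurableSpace α] [PseudoMetricSpace E]

/-- A strongly measurable function admits a countable measurable partition of its domain into
sets on which it oscillates by less than `ε`. -/
theorem exists_measurable_label {T : α → E} (hT : StronglyMeasurable T) {ε : ℝ} (hε : 0 < ε) :
    ∃ n : α → ℕ, Measurable n ∧ ∀ a b, n a = n b → dist (T a) (T b) < ε := by
  classical
  rcases isEmpty_or_nonempty α with hα | hα
  · exact ⟨fun _ => 0, measurable_const, fun a => (hα.false a).elim⟩
  obtain ⟨c, hc, hdense⟩ := hT.isSeparable_range
  have hne : c.Nonempty := by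
    by_contra h
    rw [Set.not_nonempty_iff_eq_empty] at h
    obtain ⟨a⟩ := hα
    have := hdense ⟨a, rfl⟩
    simp [h] at this
  obtain ⟨u, hu⟩ := hc.exists_eq_range hne
  have hex : ∀ a, ∃ n, dist (T a) (u n) < ε / 2 := by
    intro a
    have := hdense ⟨a, rfl⟩
    rw [Metric.mem_closure_iff] at this
    obtain ⟨b, hb, hd⟩ := this (ε / 2) (half_pos hε)
    rw [hu] at hb
    obtain ⟨n, rfl⟩ := hb
    exact ⟨n, hd⟩
  -- The label is the first index whose dense point lies within `ε / 2`; equal labels mean a common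
  -- centre.
  refine ⟨fun a => Nat.find (hex a), measurable_find _ fun k => ?_, fun a b hab => ?_⟩
  · have : StronglyMeasurable fun a => dist (T a) (u k) := hT.dist stronglyMeasurable_const
    exact measurableSet_lt this.measurable measurable_const
  · have ha := Nat.find_spec (hex a)
    have hb := Nat.find_spec (hex b)
    simp only at hab
    rw [← hab] at hb
    calc dist (T a) (T b) ≤ _ := dist_triangle_right _ _ _
      _ < ε := by linarith

/-- A function that for every `ε > 0` oscillates by at most `ε` on the pieces of some countable
measurable partition is strongly measurable. -/
theorem stronglyMeasurable_of_label {g : α → E}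
    (h : ∀ ε > 0, ∃ (ι : Type) (_ : Countable ι) (n : α → ι),
      (∀ i, MeasurableSet (n ⁻¹' {i})) ∧ ∀ a b, n a = n b → dist (g a) (g b) ≤ ε) :
    StronglyMeasurable g := by
  classical
  rcases isEmpty_or_nonempty α with hα | ⟨⟨a₀⟩⟩
  · have : g = fun _ => g (hα.elim ‹_›) := funext fun a => (hα.false a).elim
    exact ⟨fun _ => ⟨g, fun _ => by
      convert MeasurableSet.empty
      exact Set.eq_empty_of_isEmpty _, Set.toFinite _⟩, fun a => (hα.false a).elim⟩
  choose ι hι n hn hg using fun k : ℕ => h (1 / ((k : ℝ) + 1)) (by positivity)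
  -- A representative of each piece. Replacing a point by its representative gives countably-valued
  -- measurable functions converging to `g`; the value `a₀` on empty pieces is never evaluated.
  let p : ∀ k, ι k → α := fun k i => if h : ∃ a, n k a = i then h.choose else a₀
  have hp : ∀ k a, n k (p k (n k a)) = n k a := by
    intro k a
    have h : ∃ b, n k b = n k a := ⟨a, rfl⟩
    simp only [p, dif_pos h]
    exact h.choose_spec
  refine stronglyMeasurable_of_tendsto (u := atTop) (f := fun k a => g (p k (n k a))) ?_ ?_
  · intro k
    let _ : MeasurableSpace (ι k) := ⊤
    have hm : Measurable (n k) := measurable_to_countable' (hn k)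
    exact (StronglyMeasurable.of_discrete (f := fun i => g (p k i))).comp_measurable hm
  · refine tendsto_pi_nhds.2 fun a => ?_
    rw [tendsto_iff_dist_tendsto_zero]
    exact squeeze_zero (fun _ => dist_nonneg) (fun k => hg k _ _ (hp k a))
      tendsto_one_div_add_atTop_nhds_zero_nat

end Measurability

/-! ## Operations on admissible functions -/

section Maps

variable {X₀ X₁ V W₀ W₁ U : Type*} [NormedAddCommGroup X₀] [NormedSpace ℂ X₀]
  [NormedAddCommGroup X₁] [NormedSpace ℂ X₁]
  [AddCommGroup V] [Module ℂ V] [TopologicalSpace V] [IsTopologicalAddGroup V] [T2Space V]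
  {ι₀ : X₀ →L[ℂ] V} {ι₁ : X₁ →L[ℂ] V}
  [NormedAddCommGroup W₀] [NormedSpace ℂ W₀]
  [NormedAddCommGroup W₁] [NormedSpace ℂ W₁]
  [AddCommGroup U] [Module ℂ U] [TopologicalSpace U] [IsTopologicalAddGroup U] [T2Space U]
  {κ₀ : W₀ →L[ℂ] U} {κ₁ : W₁ →L[ℂ] U}

theorem SumSpace.incl_injective : Function.Injective (SumSpace.incl ι₀ ι₁) := by
  rw [← LinearMap.ker_eq_bot]
  exact Submodule.ker_liftQ_eq_bot _ _ _ le_rfl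

/-- A pair of bounded operators `W₀ → X₀`, `W₁ → X₁` that are compatible with a linear map of the
ambient spaces induces a bounded operator `W₀ + W₁ → X₀ + X₁`. -/
theorem SumSpace.exists_map (D₀ : W₀ →L[ℂ] X₀) (D₁ : W₁ →L[ℂ] X₁) (T : U →ₗ[ℂ] V)
    (h₀ : ∀ w, T (κ₀ w) = ι₀ (D₀ w)) (h₁ : ∀ w, T (κ₁ w) = ι₁ (D₁ w)) :
    ∃ P : SumSpace κ₀ κ₁ →L[ℂ] SumSpace ι₀ ι₁,
      (∀ w, P (SumSpace.inl κ₀ κ₁ w) = SumSpace.inl ι₀ ι₁ (D₀ w)) ∧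
      (∀ w, P (SumSpace.inr κ₀ κ₁ w) = SumSpace.inr ι₀ ι₁ (D₁ w)) ∧
      ∀ q, SumSpace.incl ι₀ ι₁ (P q) = T (SumSpace.incl κ₀ κ₁ q) := by
  let L : WithLp 1 (W₀ × W₁) →ₗ[ℂ] SumSpace ι₀ ι₁ :=
    (SumSpace.inl ι₀ ι₁).comp (D₀.toLinearMap.comp (WithLp.fstL 1 ℂ W₀ W₁).toLinearMap) +
    (SumSpace.inr ι₀ ι₁).comp (D₁.toLinearMap.comp (WithLp.sndL 1 ℂ W₀ W₁).toLinearMap)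
  have hL : ∀ w, L w = SumSpace.inl ι₀ ι₁ (D₀ w.fst) + SumSpace.inr ι₀ ι₁ (D₁ w.snd) :=
    fun w => rfl
  have hincl : ∀ w, SumSpace.incl ι₀ ι₁ (L w) = T (addMap κ₀ κ₁ w) := by
    intro w
    rw [hL, map_add, SumSpace.incl_inl, SumSpace.incl_inr, ← h₀, ← h₁, ← map_add]
    rfl
  -- Compatibility with `T` sends a pair with zero sum in `U` to one with zero sum in `V`, so `L`
  -- descends to the quotient.
  have hker : (addMap κ₀ κ₁).ker ≤ L.ker := by
    intro w hw
    refine SumSpace.incl_injective ?_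
    have hw' : addMap κ₀ κ₁ w = 0 := hw
    rw [hincl, hw', map_zero, map_zero]
  have hcont : Continuous L := by
    have hl : Continuous (SumSpace.inl ι₀ ι₁) :=
      AddMonoidHomClass.continuous_of_bound _ 1 fun x => by
        simpa using SumSpace.norm_inl_le ι₀ ι₁ x
    have hr : Continuous (SumSpace.inr ι₀ ι₁) :=
      AddMonoidHomClass.continuous_of_bound _ 1 fun x => by
        simpa using SumSpace.norm_inr_le ι₀ ι₁ x
    exact (hl.comp (D₀.continuous.comp (WithLp.fstL 1 ℂ W₀ W₁).continuous)).add
      (hr.comp (D₁.continuous.comp (WithLp.sndL 1 ℂ W₀ W₁).continuous))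
  let P : SumSpace κ₀ κ₁ →ₗ[ℂ] SumSpace ι₀ ι₁ := (addMap κ₀ κ₁).ker.liftQ L hker
  have hP : ∀ w, P (Submodule.Quotient.mk w) = L w := fun w => rfl
  have hPc : Continuous P := hcont.quotient_lift _
  refine ⟨⟨P, hPc⟩, fun w => ?_, fun w => ?_, fun q => ?_⟩
  · change P (Submodule.Quotient.mk _) = _
    rw [hP, hL]
    simp
  · change P (Submodule.Quotient.mk _) = _
    rw [hP, hL]
    simp
  · obtain ⟨w, rfl⟩ := Submodule.Quotient.mk_surjective _ q
    exact hincl w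

/-- Postcomposition of a `C₀` function with a bounded operator. -/
def zeroAtInftyMap (D : W₀ →L[ℂ] X₀) (g : ZeroAtInftyContinuousMap ℝ W₀) :
    ZeroAtInftyContinuousMap ℝ X₀ where
  toFun t := D (g t)
  continuous_toFun := D.continuous.comp g.continuous
  zero_at_infty' := by
    have := (D.continuous.tendsto 0).comp g.zero_at_infty'
    rwa [map_zero] at this

theorem zeroAtInfty_norm_le {E : Type*} [NormedAddCommGroup E]
    {g : ZeroAtInftyContinuousMap ℝ E} {K : ℝ} (hK : 0 ≤ K) (h : ∀ t, ‖g t‖ ≤ K) : ‖g‖ ≤ K :=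
  (BoundedContinuousFunction.norm_le hK (f := g.toBCF)).2 h

theorem Admissible.map {f : ℂ → SumSpace κ₀ κ₁} {g₀ g₁} (h : Admissible κ₀ κ₁ f g₀ g₁)
    {D₀ : W₀ →L[ℂ] X₀} {D₁ : W₁ →L[ℂ] X₁} (P : SumSpace κ₀ κ₁ →L[ℂ] SumSpace ι₀ ι₁)
    (hP₀ : ∀ w, P (SumSpace.inl κ₀ κ₁ w) = SumSpace.inl ι₀ ι₁ (D₀ w))
    (hP₁ : ∀ w, P (SumSpace.inr κ₀ κ₁ w) = SumSpace.inr ι₀ ι₁ (D₁ w)) :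
    Admissible ι₀ ι₁ (fun z => P (f z)) (zeroAtInftyMap D₀ g₀) (zeroAtInftyMap D₁ g₁) where
  diffContOnCl := P.differentiable.comp_diffContOnCl h.diffContOnCl
  bounded := by
    obtain ⟨M, hM⟩ := h.bounded
    exact ⟨‖P‖ * M, fun z hz => P.le_opNorm_of_le (hM z hz)⟩
  left t := by rw [h.left, hP₀]; rfl
  right t := by rw [h.right, hP₁]; rfl

/-- Multiplying an admissible function by a bounded holomorphic scalar function `m` bounds the
norm of the interpolated vector. -/
theorem Admissible.norm_mul_le {f : ℂ → SumSpace ι₀ ι₁} {g₀ g₁} (h : Admissible ι₀ ι₁ f g₀ g₁)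
    {θ : Set.Icc (0 : ℝ) 1} {x : Interp ι₀ ι₁ θ}
    (hx : f ((θ : ℝ) : ℂ) = Interp.toSum ι₀ ι₁ θ x) {m : ℂ → ℂ}
    (hm : DiffContOnCl ℂ m (verticalStrip 0 1))
    {M K : ℝ} (hM : ∀ z ∈ verticalClosedStrip 0 1, ‖m z‖ ≤ M) (hK : 0 ≤ K)
    (h₀ : ∀ t : ℝ, ‖m (t * Complex.I)‖ * ‖g₀ t‖ ≤ K)
    (h₁ : ∀ t : ℝ, ‖m (1 + t * Complex.I)‖ * ‖g₁ t‖ ≤ K) :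
    ‖m ((θ : ℝ) : ℂ)‖ * ‖x‖ ≤ K := by
  have hcl : closure (verticalStrip 0 1) = verticalClosedStrip 0 1 := by
    rw [verticalStrip, verticalClosedStrip, Complex.closure_preimage_re, closure_Ioo zero_ne_one]
  have hmc : ContinuousOn m (verticalClosedStrip 0 1) := hcl ▸ hm.continuousOn
  have hmem₀ : ∀ t : ℝ, (t : ℂ) * Complex.I ∈ verticalClosedStrip 0 1 := fun t => by
    simp [verticalClosedStrip]
  have hmem₁ : ∀ t : ℝ, 1 + (t : ℂ) * Complex.I ∈ verticalClosedStrip 0 1 := fun t => by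
    simp [verticalClosedStrip]
  have hc₀ : Continuous fun t : ℝ => m (t * Complex.I) :=
    hmc.comp_continuous (by fun_prop) hmem₀
  have hc₁ : Continuous fun t : ℝ => m (1 + t * Complex.I) :=
    hmc.comp_continuous (by fun_prop) hmem₁
  let G₀ : ZeroAtInftyContinuousMap ℝ X₀ :=
    { toFun := fun t => m (t * Complex.I) • g₀ t
      continuous_toFun := hc₀.smul g₀.continuous
      zero_at_infty' := by
        refine squeeze_zero_norm (a := fun t => M * ‖g₀ t‖) (fun t => ?_) ?_
        · rw [norm_smul]
          exact mul_le_mul_of_nonneg_right (hM _ (hmem₀ t)) (norm_nonneg _)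
        · simpa using (g₀.zero_at_infty'.norm).const_mul M }
  let G₁ : ZeroAtInftyContinuousMap ℝ X₁ :=
    { toFun := fun t => m (1 + t * Complex.I) • g₁ t
      continuous_toFun := hc₁.smul g₁.continuous
      zero_at_infty' := by
        refine squeeze_zero_norm (a := fun t => M * ‖g₁ t‖) (fun t => ?_) ?_
        · rw [norm_smul]
          exact mul_le_mul_of_nonneg_right (hM _ (hmem₁ t)) (norm_nonneg _)
        · simpa using (g₁.zero_at_infty'.norm).const_mul M }
  have hA : Admissible ι₀ ι₁ (fun z => m z • f z) G₀ G₁ :=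
    { diffContOnCl := hm.smul h.diffContOnCl
      bounded := by
        obtain ⟨M', hM'⟩ := h.bounded
        refine ⟨M * M', fun z hz => ?_⟩
        rw [norm_smul]
        exact mul_le_mul (hM z hz) (hM' z hz) (norm_nonneg _)
          ((norm_nonneg _).trans (hM z hz))
      left := fun t => by rw [h.left, ← map_smul]; rfl
      right := fun t => by rw [h.right, ← map_smul]; rfl }
  rw [← norm_smul]
  refine (Interp.norm_le ι₀ ι₁ θ (x := m ((θ : ℝ) : ℂ) • x) hA ?_).trans ?_
  · rw [map_smul, ← hx]
  · refine max_le (zeroAtInfty_norm_le hK fun t => ?_) (zeroAtInfty_norm_le hK fun t => ?_)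
    · exact (norm_smul _ _).trans_le (h₀ t)
    · exact (norm_smul _ _).trans_le (h₁ t)

end Maps

/-! ## Norm estimates in the complex interpolation space -/

section Estimates

variable {X₀ X₁ V : Type*} [NormedAddCommGroup X₀] [NormedSpace ℂ X₀]
  [NormedAddCommGroup X₁] [NormedSpace ℂ X₁]
  [AddCommGroup V] [Module ℂ V] [TopologicalSpace V] [IsTopologicalAddGroup V] [T2Space V]
  {ι₀ : X₀ →L[ℂ] V} {ι₁ : X₁ →L[ℂ] V}

/-- A narrow Gaussian sees only the value at `0`: continuity handles `|t| < δ`. For `|t| ≥ δ` the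
choice of `M` makes the exponent at least `‖v‖ / ε`, and `x + 1 ≤ exp x` gives the bound `ε`. -/
theorem exists_gaussian_mul_le {E : Type*} [NormedAddCommGroup E]
    (v : ZeroAtInftyContinuousMap ℝ E) {ε : ℝ} (hε : 0 < ε) :
    ∃ M : ℝ, 0 ≤ M ∧ ∀ t : ℝ, Real.exp (-(M * t ^ 2)) * ‖v t‖ ≤ ‖v 0‖ + ε := by
  obtain ⟨δ, hδ, hv⟩ := Metric.continuous_iff.1 (map_continuous v) 0 ε hε
  refine ⟨‖v‖ / ε / δ ^ 2, by positivity, fun t => ?_⟩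
  have hM : 0 ≤ ‖v‖ / ε / δ ^ 2 * t ^ 2 := by positivity
  rcases lt_or_ge |t| δ with h | h
  · have h1 : ‖v t‖ ≤ ‖v 0‖ + ε := by
      have := hv t (by simpa [Real.dist_eq] using h)
      rw [dist_eq_norm] at this
      linarith [norm_le_norm_add_norm_sub' (v t) (v 0)]
    calc _ ≤ 1 * ‖v t‖ := by
          gcongr
          exact Real.exp_le_one_iff.2 (by linarith)
      _ ≤ _ := by linarith
  · have h2 : ‖v‖ / ε ≤ ‖v‖ / ε / δ ^ 2 * t ^ 2 := by
      rw [div_mul_eq_mul_div, le_div_iff₀ (by positivity)]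
      refine mul_le_mul_of_nonneg_left ?_ (by positivity)
      rw [← sq_abs t]
      gcongr
    have h3 : ‖v‖ ≤ ε * Real.exp (‖v‖ / ε / δ ^ 2 * t ^ 2) := by
      rw [← div_le_iff₀' hε]
      linarith [Real.add_one_le_exp (‖v‖ / ε / δ ^ 2 * t ^ 2)]
    have h4 : Real.exp (-(‖v‖ / ε / δ ^ 2 * t ^ 2)) * ‖v t‖ ≤ ε := by
      rw [Real.exp_neg, inv_mul_le_iff₀ (Real.exp_pos _), mul_comm]
      exact (zeroAtInfty_norm_apply_le v t).trans h3
    linarith [norm_nonneg (v 0)]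

theorem exists_exp_neg_mul_le {a ε : ℝ} (ha : 0 ≤ a) (hε : 0 < ε) :
    ∃ k : ℝ, 0 ≤ k ∧ Real.exp (-k) * a ≤ ε := by
  refine ⟨a / ε, by positivity, ?_⟩
  rw [Real.exp_neg, inv_mul_le_iff₀ (Real.exp_pos _), ← div_le_iff₀ hε]
  linarith [Real.add_one_le_exp (a / ε)]

/-- The multiplier `exp(Mz² - (M+k)z)` equals `1` at `0` and has modulus `exp(-Mt²)` on the left
line, which localizes `g₀` at `0`. On the right line its modulus is `exp(-Mt² - k)`, which makes
`g₁` negligible for large `k`. -/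
theorem Admissible.norm_le_of_eq_zero {f : ℂ → SumSpace ι₀ ι₁} {g₀ g₁}
    (h : Admissible ι₀ ι₁ f g₀ g₁) {θ : Set.Icc (0 : ℝ) 1} (hθ : (θ : ℝ) = 0)
    {x : Interp ι₀ ι₁ θ} (hx : f ((θ : ℝ) : ℂ) = Interp.toSum ι₀ ι₁ θ x) : ‖x‖ ≤ ‖g₀ 0‖ := by
  refine le_of_forall_pos_le_add fun ε hε => ?_
  obtain ⟨M, hM0, hM⟩ := exists_gaussian_mul_le g₀ hε
  obtain ⟨k, hk0, hk⟩ := exists_exp_neg_mul_le (norm_nonneg g₁) hε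
  let m : ℂ → ℂ := fun z => Complex.exp ((M : ℂ) * z ^ 2 - ((M + k : ℝ) : ℂ) * z)
  have hre : ∀ z : ℂ, ‖m z‖ = Real.exp (M * (z.re ^ 2 - z.im ^ 2) - (M + k) * z.re) := fun z => by
    simp [m, Complex.norm_exp, sq]
  have key := h.norm_mul_le hx (m := m) (M := Real.exp M) (K := ‖g₀ 0‖ + ε)
    (Differentiable.diffContOnCl (by fun_prop)) (fun z hz => ?_) (by positivity)
    (fun t => ?_) (fun t => ?_)
  · have : m ((θ : ℝ) : ℂ) = 1 := by simp [m, hθ]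
    rwa [this, norm_one, one_mul] at key
  · obtain ⟨h1, h2⟩ : z.re ∈ Set.Icc 0 1 := hz
    rw [hre, Real.exp_le_exp]
    have : z.re ^ 2 ≤ 1 := by nlinarith
    nlinarith [sq_nonneg z.im, mul_nonneg hM0 (sq_nonneg z.im), mul_nonneg hk0 h1,
      mul_nonneg hM0 h1]
  · rw [hre]
    simpa using hM t
  · rw [hre]
    refine le_trans ?_ (hk.trans (by linarith [norm_nonneg (g₀ 0)]))
    gcongr
    · simp only [Complex.add_re, Complex.one_re, Complex.mul_re, Complex.ofReal_re, Complex.I_re,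
        Complex.ofReal_im, Complex.I_im, Complex.add_im, Complex.one_im, Complex.mul_im]
      nlinarith [mul_nonneg hM0 (sq_nonneg t)]
    · exact zeroAtInfty_norm_apply_le g₁ t

/-- The case of the left endpoint with its multiplier reflected by `z ↦ 1 - z`. -/
theorem Admissible.norm_le_of_eq_one {f : ℂ → SumSpace ι₀ ι₁} {g₀ g₁}
    (h : Admissible ι₀ ι₁ f g₀ g₁) {θ : Set.Icc (0 : ℝ) 1} (hθ : (θ : ℝ) = 1)
    {x : Interp ι₀ ι₁ θ} (hx : f ((θ : ℝ) : ℂ) = Interp.toSum ι₀ ι₁ θ x) : ‖x‖ ≤ ‖g₁ 0‖ := by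
  refine le_of_forall_pos_le_add fun ε hε => ?_
  obtain ⟨M, hM0, hM⟩ := exists_gaussian_mul_le g₁ hε
  obtain ⟨k, hk0, hk⟩ := exists_exp_neg_mul_le (norm_nonneg g₀) hε
  let m : ℂ → ℂ := fun z => Complex.exp ((M : ℂ) * (z - 1) ^ 2 + ((M + k : ℝ) : ℂ) * (z - 1))
  have hre : ∀ z : ℂ, ‖m z‖ =
      Real.exp (M * ((z.re - 1) ^ 2 - z.im ^ 2) + (M + k) * (z.re - 1)) := fun z => by
    simp [m, Complex.norm_exp, sq]
  have key := h.norm_mul_le hx (m := m) (M := Real.exp M) (K := ‖g₁ 0‖ + ε)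
    (Differentiable.diffContOnCl (by fun_prop)) (fun z hz => ?_) (by positivity)
    (fun t => ?_) (fun t => ?_)
  · have : m ((θ : ℝ) : ℂ) = 1 := by simp [m, hθ]
    rwa [this, norm_one, one_mul] at key
  · obtain ⟨h1, h2⟩ : z.re ∈ Set.Icc 0 1 := hz
    rw [hre, Real.exp_le_exp]
    have : (z.re - 1) ^ 2 ≤ 1 := by nlinarith
    nlinarith [sq_nonneg z.im, mul_nonneg hM0 (sq_nonneg z.im), mul_nonneg hk0 (sub_nonneg.2 h2),
      mul_nonneg hM0 (sub_nonneg.2 h2)]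
  · rw [hre]
    refine le_trans ?_ (hk.trans (by linarith [norm_nonneg (g₁ 0)]))
    gcongr
    · simp only [Complex.mul_re, Complex.ofReal_re, Complex.I_re,
        Complex.ofReal_im, Complex.I_im, Complex.mul_im]
      nlinarith [mul_nonneg hM0 (sq_nonneg t)]
    · exact zeroAtInfty_norm_apply_le g₀ t
  · rw [hre]
    simpa using hM t

/-- If `H₀` and `H₁` are holomorphic with real part bounded away from zero and dominate the
boundary values of an admissible function `f` on the two boundary lines, up to a Gaussian factor,
then `‖f(θ)‖ ≲ |H₀(θ)|^{1-θ} |H₁(θ)|^θ`. -/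
theorem Admissible.norm_le_mul_rpow {f : ℂ → SumSpace ι₀ ι₁} {g₀ g₁}
    (h : Admissible ι₀ ι₁ f g₀ g₁) {θ : Set.Icc (0 : ℝ) 1}
    {x : Interp ι₀ ι₁ θ} (hx : f ((θ : ℝ) : ℂ) = Interp.toSum ι₀ ι₁ θ x)
    {H₀ H₁ : ℂ → ℂ} {ε M : ℝ} (hε : 0 < ε)
    (hd₀ : ∀ z ∈ verticalClosedStrip 0 1, DifferentiableAt ℂ H₀ z)
    (hd₁ : ∀ z ∈ verticalClosedStrip 0 1, DifferentiableAt ℂ H₁ z)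
    (hl₀ : ∀ z ∈ verticalClosedStrip 0 1, ε ≤ (H₀ z).re)
    (hl₁ : ∀ z ∈ verticalClosedStrip 0 1, ε ≤ (H₁ z).re)
    (hu₀ : ∀ z ∈ verticalClosedStrip 0 1, ‖H₀ z‖ ≤ M)
    (hu₁ : ∀ z ∈ verticalClosedStrip 0 1, ‖H₁ z‖ ≤ M)
    (hg₀ : ∀ t : ℝ, Real.exp (-t ^ 2) * ‖g₀ t‖ ≤ ‖H₀ (t * Complex.I)‖)
    (hg₁ : ∀ t : ℝ, Real.exp (-t ^ 2) * ‖g₁ t‖ ≤ ‖H₁ (1 + t * Complex.I)‖) :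
    ‖x‖ ≤ Real.exp (2 + Real.pi ^ 2) *
      (‖H₀ ((θ : ℝ) : ℂ)‖ ^ (1 - (θ : ℝ)) * ‖H₁ ((θ : ℝ) : ℂ)‖ ^ (θ : ℝ)) := by
  obtain ⟨θ, hθ0, hθ1⟩ := θ
  simp only at hx ⊢
  -- This is `exp(2(z-θ)²) / (H₀^{1-z} H₁^z)`. Of the decay `exp(-2y²)`, one factor `exp(-y²)` is
  -- the Gaussian in the hypotheses on `g₀`, `g₁`; the other absorbs the arguments of `H₀` and `H₁`.
  let m : ℂ → ℂ := fun z => Complex.exp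
    (2 * (z - (θ : ℂ)) ^ 2 - ((1 - z) * Complex.log (H₀ z) + z * Complex.log (H₁ z)))
  have hcl : closure (verticalStrip 0 1) = verticalClosedStrip 0 1 := by
    rw [verticalStrip, verticalClosedStrip, Complex.closure_preimage_re, closure_Ioo zero_ne_one]
  have hpos₀ : ∀ z ∈ verticalClosedStrip 0 1, ε ≤ ‖H₀ z‖ := fun z hz =>
    (hl₀ z hz).trans (Complex.re_le_norm _)
  have hpos₁ : ∀ z ∈ verticalClosedStrip 0 1, ε ≤ ‖H₁ z‖ := fun z hz =>
    (hl₁ z hz).trans (Complex.re_le_norm _)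
  have hnorm : ∀ z, ‖m z‖ = Real.exp (2 * ((z.re - θ) ^ 2 - z.im ^ 2)
      - ((1 - z.re) * Real.log ‖H₀ z‖ + z.im * (H₀ z).arg
        + z.re * Real.log ‖H₁ z‖ - z.im * (H₁ z).arg)) := fun z => by
    simp only [m, Complex.norm_exp]
    congr 1
    simp [sq, Complex.log_re, Complex.log_im]
    ring
  -- Arguments differ by at most `2π`, and `2π|y| ≤ y² + π²`; this is the source of `π²` in the
  -- constant. The `2` there comes from `2(Re z - θ)² ≤ 2`.
  have harg : ∀ (y : ℝ) (w w' : ℂ), -(y * w.arg) + y * w'.arg ≤ y ^ 2 + Real.pi ^ 2 := by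
    intro y w w'
    have h1 := abs_le.1 (Complex.abs_arg_le_pi w)
    have h2 := abs_le.1 (Complex.abs_arg_le_pi w')
    have h3 : |y * (w'.arg - w.arg)| ≤ |y| * (2 * Real.pi) := by
      rw [abs_mul]
      gcongr
      exact abs_le.2 ⟨by linarith, by linarith⟩
    have h4 := (abs_le.1 h3).2
    nlinarith [sq_nonneg (|y| - Real.pi), sq_abs y]
  have hlog : ∀ w : ℂ, ε ≤ ‖w‖ → ‖w‖ ≤ M →
      |Real.log ‖w‖| ≤ |Real.log ε| + |Real.log M| := by
    intro w h1 h2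
    have h3 := Real.log_le_log hε h1
    have h4 := Real.log_le_log (hε.trans_le h1) h2
    exact abs_le.2 ⟨by linarith [neg_abs_le (Real.log ε), abs_nonneg (Real.log M)],
      by linarith [le_abs_self (Real.log M), abs_nonneg (Real.log ε)]⟩
  have key := h.norm_mul_le (θ := ⟨θ, hθ0, hθ1⟩) hx (m := m)
    (M := Real.exp (2 + Real.pi ^ 2 + 2 * (|Real.log ε| + |Real.log M|)))
    (K := Real.exp (2 + Real.pi ^ 2)) ?_ ?_ (Real.exp_pos _).le ?_ ?_
  · have hmθ : ((θ : ℝ) : ℂ) ∈ verticalClosedStrip 0 1 := by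
      simpa [verticalClosedStrip] using ⟨hθ0, hθ1⟩
    have p₀ := hε.trans_le (hpos₀ _ hmθ)
    have p₁ := hε.trans_le (hpos₁ _ hmθ)
    have hval : ‖m (θ : ℂ)‖ * (‖H₀ (θ : ℂ)‖ ^ (1 - θ) * ‖H₁ (θ : ℂ)‖ ^ θ) = 1 := by
      rw [hnorm, Real.rpow_def_of_pos p₀, Real.rpow_def_of_pos p₁, ← Real.exp_add, ← Real.exp_add,
        Real.exp_eq_one_iff]
      simp
      ring
    calc ‖x‖ = (‖m (θ : ℂ)‖ * ‖x‖) * (‖H₀ (θ : ℂ)‖ ^ (1 - θ) * ‖H₁ (θ : ℂ)‖ ^ θ) := by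
          rw [mul_right_comm, hval, one_mul]
      _ ≤ _ := by
          gcongr
  -- Positive real part keeps `H` in the domain of holomorphy of the principal logarithm.
  · have hlogd : ∀ H : ℂ → ℂ, (∀ z ∈ verticalClosedStrip 0 1, DifferentiableAt ℂ H z) →
        (∀ z ∈ verticalClosedStrip 0 1, ε ≤ (H z).re) →
        ∀ z ∈ verticalClosedStrip 0 1, DifferentiableAt ℂ (fun z => Complex.log (H z)) z :=
      fun H hd hl z hz => (hd z hz).clog (Or.inl (hε.trans_le (hl z hz)))
    refine DifferentiableOn.diffContOnCl fun z hz => ?_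
    rw [hcl] at hz
    have d₀ := hlogd H₀ hd₀ hl₀ z hz
    have d₁ := hlogd H₁ hd₁ hl₁ z hz
    refine DifferentiableAt.differentiableWithinAt ?_
    fun_prop
  · intro z hz
    have b₀ := hlog _ (hpos₀ z hz) (hu₀ z hz)
    have b₁ := hlog _ (hpos₁ z hz) (hu₁ z hz)
    set Λ := |Real.log ε| + |Real.log M|
    obtain ⟨h1, h2⟩ : z.re ∈ Set.Icc 0 1 := hz
    rw [hnorm, Real.exp_le_exp]
    have a := harg z.im (H₀ z) (H₁ z)
    have c₀ : -((1 - z.re) * Real.log ‖H₀ z‖) ≤ Λ := by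
      have := (abs_le.1 b₀).1
      nlinarith [(abs_nonneg _).trans b₀]
    have c₁ : -(z.re * Real.log ‖H₁ z‖) ≤ Λ := by
      have := (abs_le.1 b₁).1
      nlinarith [(abs_nonneg _).trans b₁]
    have c₂ : (z.re - θ) ^ 2 ≤ 1 := by nlinarith
    nlinarith [sq_nonneg z.im]
  · intro t
    have hz : (t : ℂ) * Complex.I ∈ verticalClosedStrip 0 1 := by simp [verticalClosedStrip]
    have p := hε.trans_le (hpos₀ _ hz)
    have hb : ‖m (t * Complex.I)‖ ≤
        Real.exp (2 + Real.pi ^ 2) * (Real.exp (-t ^ 2) / ‖H₀ (t * Complex.I)‖) := by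
      rw [hnorm, ← Real.exp_log p, ← Real.exp_sub, ← Real.exp_add, Real.exp_log p,
        Real.exp_le_exp]
      have a := harg t (H₀ (t * Complex.I)) (H₁ (t * Complex.I))
      simp
      nlinarith
    calc _ ≤ Real.exp (2 + Real.pi ^ 2) *
          (Real.exp (-t ^ 2) / ‖H₀ (t * Complex.I)‖) * ‖g₀ t‖ := by gcongr
      _ = Real.exp (2 + Real.pi ^ 2) *
          ((Real.exp (-t ^ 2) * ‖g₀ t‖) / ‖H₀ (t * Complex.I)‖) := by ring
      _ ≤ Real.exp (2 + Real.pi ^ 2) * 1 := by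
          gcongr
          exact (div_le_one p).2 (hg₀ t)
      _ = _ := mul_one _
  · intro t
    have hz : 1 + (t : ℂ) * Complex.I ∈ verticalClosedStrip 0 1 := by simp [verticalClosedStrip]
    have p := hε.trans_le (hpos₁ _ hz)
    have hb : ‖m (1 + t * Complex.I)‖ ≤
        Real.exp (2 + Real.pi ^ 2) * (Real.exp (-t ^ 2) / ‖H₁ (1 + t * Complex.I)‖) := by
      rw [hnorm, ← Real.exp_log p, ← Real.exp_sub, ← Real.exp_add, Real.exp_log p,
        Real.exp_le_exp]
      have a := harg t (H₀ (1 + t * Complex.I)) (H₁ (1 + t * Complex.I))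
      simp
      nlinarith
    calc _ ≤ Real.exp (2 + Real.pi ^ 2) *
          (Real.exp (-t ^ 2) / ‖H₁ (1 + t * Complex.I)‖) * ‖g₁ t‖ := by gcongr
      _ = Real.exp (2 + Real.pi ^ 2) *
          ((Real.exp (-t ^ 2) * ‖g₁ t‖) / ‖H₁ (1 + t * Complex.I)‖) := by ring
      _ ≤ Real.exp (2 + Real.pi ^ 2) * 1 := by
          gcongr
          exact (div_le_one p).2 (hg₁ t)
      _ = _ := mul_one _

end Estimates

/-! ## Holomorphic majorants given by discretized Poisson integrals -/

section Majorant

/-- The function `z ↦ ε + ∑_{s ∈ S} a_s / (z + δ - i s)`, holomorphic for `Re z > -δ`. -/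
noncomputable def cauchySum (ε δ : ℝ) (S : Finset ℝ) (a : ℝ → ℝ) (z : ℂ) : ℂ :=
  ε + ∑ s ∈ S, (a s : ℂ) / (z + δ - s * Complex.I)

variable {ε δ : ℝ} {S : Finset ℝ} {a : ℝ → ℝ}

theorem re_add_sub_mul_I (z : ℂ) (δ s : ℝ) : (z + δ - s * Complex.I).re = z.re + δ := by simp

theorem cauchySum_differentiableAt (hδ : 0 < δ) {z : ℂ} (hz : 0 ≤ z.re) :
    DifferentiableAt ℂ (cauchySum ε δ S a) z := by
  unfold cauchySum
  refine (differentiableAt_const _).add (DifferentiableAt.fun_sum fun s _ => ?_)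
  refine (differentiableAt_const _).div (by fun_prop) fun h => ?_
  have := re_add_sub_mul_I z δ s
  rw [h, Complex.zero_re] at this
  linarith

/-- Each summand is, up to the factor `π`, the Poisson kernel of the half-plane `Re z > -δ`. With `a
≥ 0` nothing cancels, so any single term bounds the sum from below. -/
theorem cauchySum_re (z : ℂ) : (cauchySum ε δ S a z).re =
    ε + ∑ s ∈ S, a s * ((z.re + δ) / ((z.re + δ) ^ 2 + (z.im - s) ^ 2)) := by
  simp only [cauchySum, Complex.add_re, Complex.ofReal_re, Complex.re_sum, div_eq_mul_inv,
    Complex.re_ofReal_mul, Complex.inv_re, Complex.normSq_apply]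
  simp [sq]

theorem le_cauchySum_re (hδ : 0 < δ) (ha : ∀ s, 0 ≤ a s) {z : ℂ} (hz : 0 ≤ z.re) :
    ε ≤ (cauchySum ε δ S a z).re := by
  rw [cauchySum_re]
  exact le_add_of_nonneg_right (Finset.sum_nonneg fun s _ => mul_nonneg (ha s) (by positivity))

theorem norm_cauchySum_le (hε : 0 ≤ ε) (ha : ∀ s, 0 ≤ a s) {z : ℂ} {b : ℝ}
    (hb : 0 < b) (hz : b ≤ z.re + δ) :
    ‖cauchySum ε δ S a z‖ ≤ ε + b⁻¹ * ∑ s ∈ S, a s := by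
  refine (norm_add_le _ _).trans (add_le_add (by simp [abs_of_nonneg hε]) ?_)
  rw [Finset.mul_sum]
  refine (norm_sum_le _ _).trans (Finset.sum_le_sum fun s _ => ?_)
  rw [norm_div, Complex.norm_real, Real.norm_of_nonneg (ha s), div_eq_inv_mul]
  have : b ≤ ‖z + δ - s * Complex.I‖ :=
    (hz.trans_eq (re_add_sub_mul_I z δ s).symm).trans (Complex.re_le_norm _)
  exact mul_le_mul_of_nonneg_right (inv_anti₀ hb this) (ha s)

/-- A Riemann sum for `∫ dy / (1 + y²)`, bounded by telescoping against `2y / (1 + y)`, whose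
derivative `2 / (1 + y)²` dominates `1 / (1 + y²)`. The bound is uniform in `n`. -/
theorem sum_range_div_one_add_sq_le (hδ : 0 ≤ δ) (n : ℕ) :
    ∑ k ∈ Finset.range (n + 1), δ / (1 + (k * δ) ^ 2) ≤ δ + 2 * (n * δ) / (1 + n * δ) := by
  induction n with
  | zero => simp
  | succ n ih =>
    rw [Finset.sum_range_succ]
    have h0 : 0 ≤ n * δ := by positivity
    have hs : ((n + 1 : ℕ) : ℝ) * δ = n * δ + δ := by push_cast; ring
    rw [hs]
    set y := (n : ℝ) * δ
    have : 2 * (y + δ) / (1 + (y + δ)) - 2 * y / (1 + y) = 2 * δ / ((1 + (y + δ)) * (1 + y)) := by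
      field_simp
      ring
    have h2 : δ / (1 + (y + δ) ^ 2) ≤ 2 * δ / ((1 + (y + δ)) * (1 + y)) := by
      rw [div_le_div_iff₀ (by positivity) (by positivity)]
      have : (1 + (y + δ)) * (1 + y) ≤ 2 * (1 + (y + δ) ^ 2) := by
        nlinarith [sq_nonneg (y + δ - 1)]
      nlinarith
    linarith

/-- A `C₀` function is well approximated by its values on a finite set of nodes `s`, with weights
`c s` of bounded total mass such that the corresponding Poisson kernels dominate a Gaussian. -/
theorem exists_nodes {E : Type*} [NormedAddCommGroup E] (v : ZeroAtInftyContinuousMap ℝ E)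
    {ε : ℝ} (hε : 0 < ε) :
    ∃ (δ : ℝ) (S : Finset ℝ) (c : ℝ → ℝ), 0 < δ ∧ (∀ s, 0 ≤ c s) ∧ ∑ s ∈ S, c s ≤ 36 ∧
      ∀ t : ℝ, ‖v t‖ ≤ ε ∨ ∃ s ∈ S, ‖v t - v s‖ ≤ ε ∧
        Real.exp (-t ^ 2) ≤ c s * (δ / (δ ^ 2 + (t - s) ^ 2)) := by
  obtain ⟨δ', hδ', huc⟩ := Metric.uniformContinuous_iff.1
    (ZeroAtInftyContinuousMap.uniformContinuous v) ε hε
  obtain ⟨R, hR⟩ : ∃ R : ℝ, ∀ t : ℝ, R < |t| → ‖v t‖ ≤ ε := by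
    have h1 : ∀ᶠ t in cocompact ℝ, ‖v t‖ < ε := by
      have := (v.zero_at_infty').norm
      rw [norm_zero] at this
      exact this.eventually_lt_const hε
    rw [← Metric.cobounded_eq_cocompact, ← comap_norm_atTop] at h1
    obtain ⟨s, hs, hs'⟩ := Filter.mem_comap.1 h1
    obtain ⟨R, hR⟩ := Filter.mem_atTop_sets.1 hs
    exact ⟨R, fun t ht => (hs' (hR _ ht.le) : ‖v t‖ < ε).le⟩
  let δ := min 1 (δ' / 2)
  have hδ : 0 < δ := lt_min one_pos (half_pos hδ')
  have hδ1 : δ ≤ 1 := min_le_left _ _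
  have hδδ : δ < δ' := (min_le_right _ _).trans_lt (half_lt_self hδ')
  obtain ⟨n, hn⟩ := exists_nat_gt (R / δ)
  rw [div_lt_iff₀ hδ] at hn
  let A := (Finset.range (n + 1)).image fun k : ℕ => (k : ℝ) * δ
  let B := (Finset.range (n + 1)).image fun k : ℕ => -((k : ℝ) * δ)
  -- If `|t - s| ≤ δ ≤ 1`, the kernel is at least `1 / (2δ)` and `1 + s² ≤ 3 exp(t²)`; the factor
  -- `6` compensates both. Each half-line of nodes then weighs at most `6 · 3 = 18`, giving `36` in
  -- total.
  let c : ℝ → ℝ := fun s => 6 * (δ / (1 + s ^ 2))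
  have hc : ∀ s, 0 ≤ c s := fun s => by positivity
  have hsum : ∑ k ∈ Finset.range (n + 1), δ / (1 + (k * δ) ^ 2) ≤ 3 := by
    refine (sum_range_div_one_add_sq_le hδ.le n).trans ?_
    have : 2 * (n * δ) / (1 + n * δ) ≤ 2 := by
      rw [div_le_iff₀ (by positivity)]
      linarith
    linarith
  have hA : ∑ s ∈ A, c s ≤ 18 := by
    rw [Finset.sum_image fun i _ j _ h => by simpa [hδ.ne'] using h, ← Finset.mul_sum]
    linarith
  have hB : ∑ s ∈ B, c s ≤ 18 := by
    rw [Finset.sum_image fun i _ j _ h => by simpa [hδ.ne'] using h, ← Finset.mul_sum]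
    simp only [neg_sq]
    linarith
  refine ⟨δ, A ∪ B, c, hδ, hc, ?_, fun t => ?_⟩
  -- The two half-lines share the node `0`, so the union is not disjoint; nonnegativity of `c`
  -- suffices.
  · have := Finset.sum_union_inter (s₁ := A) (s₂ := B) (f := c)
    have h2 : 0 ≤ ∑ s ∈ A ∩ B, c s := Finset.sum_nonneg fun s _ => hc s
    linarith
  rcases le_or_gt ((n : ℝ) * δ) |t| with ht | ht
  · exact Or.inl (hR t (hn.trans_le ht))
  right
  let k := ⌊|t| / δ⌋₊
  have hk1 : (k : ℝ) * δ ≤ |t| := (le_div_iff₀ hδ).1 (Nat.floor_le (by positivity))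
  have hk2 : |t| < (k + 1) * δ := (div_lt_iff₀ hδ).1 (Nat.lt_floor_add_one _)
  have hkn : k < n + 1 := by
    have : (k : ℝ) * δ < n * δ := hk1.trans_lt ht
    exact_mod_cast (lt_of_mul_lt_mul_right this hδ.le).trans (lt_add_one _)
  obtain ⟨s, hs, hts⟩ : ∃ s ∈ A ∪ B, |t - s| ≤ δ := by
    rcases le_total 0 t with h0 | h0
    · refine ⟨k * δ, Finset.mem_union_left _
        (Finset.mem_image_of_mem _ (Finset.mem_range.2 hkn)), ?_⟩
      rw [abs_of_nonneg h0] at hk1 hk2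
      exact abs_le.2 ⟨by linarith, by linarith⟩
    · refine ⟨-(k * δ), Finset.mem_union_right _
        (Finset.mem_image_of_mem _ (Finset.mem_range.2 hkn)), ?_⟩
      rw [abs_of_nonpos h0] at hk1 hk2
      exact abs_le.2 ⟨by linarith, by linarith⟩
  refine ⟨s, hs, ?_, ?_⟩
  · have := huc (a := t) (b := s) (by rw [Real.dist_eq]; linarith)
    rw [dist_eq_norm] at this
    exact this.le
  · have h1 : (t - s) ^ 2 ≤ δ ^ 2 := sq_le_sq' (by linarith [(abs_le.1 hts).1]) (abs_le.1 hts).2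
    have h2 : 1 + s ^ 2 ≤ 3 * Real.exp (t ^ 2) := by
      have := Real.add_one_le_exp (t ^ 2)
      have h4 : δ ^ 2 ≤ 1 := by nlinarith
      nlinarith [sq_nonneg (2 * t - s)]
    calc Real.exp (-t ^ 2) = 6 * (δ / (3 * Real.exp (t ^ 2))) * (δ / (δ ^ 2 + δ ^ 2)) := by
          rw [Real.exp_neg]
          field_simp
          norm_num
      _ ≤ _ := by
          simp only [c]
          gcongr

/-- Where `v t` is small the constant `2ε` suffices. Elsewhere `p (v t)` exceeds `p (v s)` at a
nearby node by at most `2ε`, and the term of that node dominates the Gaussian. The function `p`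
stands for the norm of an increment, so one set of nodes serves all increments. -/
theorem gaussian_mul_le_cauchySum {E : Type*} [NormedAddCommGroup E]
    {v : ℝ → E} {ε δ : ℝ} {S : Finset ℝ} {c : ℝ → ℝ} (hδ : 0 < δ) (hc : ∀ s, 0 ≤ c s)
    (hv : ∀ t : ℝ, ‖v t‖ ≤ ε ∨ ∃ s ∈ S, ‖v t - v s‖ ≤ ε ∧
        Real.exp (-t ^ 2) ≤ c s * (δ / (δ ^ 2 + (t - s) ^ 2)))
    {p : E → ℝ} (hp0 : ∀ x, 0 ≤ p x) (hp1 : ∀ x, p x ≤ 2 * ‖x‖)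
    (hp2 : ∀ x y, p x ≤ p y + 2 * ‖x - y‖) (t : ℝ) :
    Real.exp (-t ^ 2) * p (v t) ≤
      ‖cauchySum (2 * ε) δ S (fun s => c s * p (v s)) (t * Complex.I)‖ := by
  refine le_trans ?_ (Complex.re_le_norm _)
  have hexp : Real.exp (-t ^ 2) ≤ 1 := Real.exp_le_one_iff.2 (by nlinarith)
  have hexp0 := Real.exp_pos (-t ^ 2)
  have hε : 0 ≤ ε := by
    rcases hv t with h | ⟨s, _, h, _⟩ <;> exact (norm_nonneg _).trans h
  rcases hv t with h | ⟨s, hs, h1, h2⟩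
  · refine le_trans ?_ (le_cauchySum_re hδ (fun s => mul_nonneg (hc s) (hp0 _)) (by simp))
    nlinarith [hp0 (v t), hp1 (v t)]
  · rw [cauchySum_re]
    simp only [Complex.mul_re, Complex.ofReal_re, Complex.I_re, Complex.ofReal_im, Complex.I_im,
      Complex.mul_im, mul_zero, sub_zero, add_zero, zero_add, mul_one]
    have h3 := Finset.single_le_sum
      (f := fun s => c s * p (v s) * (δ / (δ ^ 2 + (t - s) ^ 2)))
      (fun s _ => mul_nonneg (mul_nonneg (hc s) (hp0 _)) (by positivity)) hs
    have h4 : Real.exp (-t ^ 2) * p (v s) ≤ c s * (δ / (δ ^ 2 + (t - s) ^ 2)) * p (v s) :=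
      mul_le_mul_of_nonneg_right h2 (hp0 _)
    have h5 : Real.exp (-t ^ 2) * p (v t) ≤ Real.exp (-t ^ 2) * (p (v s) + 2 * ε) :=
      mul_le_mul_of_nonneg_left ((hp2 _ _).trans (by linarith)) hexp0.le
    nlinarith

end Majorant

/-! ## Vectors of increments in `ℓ^s` -/

section Increments

variable {s : ℝ≥0∞} [hs : Fact (1 ≤ s)] {J : Set ℝ} {X : Type*} [NormedAddCommGroup X]
  [NormedSpace ℂ X]

/-- The increment `w ↦ w(a) - w(b)` as a bounded operator `V^s(J;X) → X`. -/
noncomputable def VSpace.incr (a b : J) : VSpace s J X →L[ℂ] X :=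
  VSpace.eval s J X a - VSpace.eval s J X b

theorem VSpace.norm_eval_le (w : VSpace s J X) (a : J) : ‖VSpace.eval s J X a w‖ ≤ ‖w‖ := by
  change ‖w.toFun a‖ ≤ (eVarNorm s w.toFun).toReal
  rw [← toReal_enorm]
  exact ENNReal.toReal_mono w.2.2.ne (enorm_le_eVarNorm s w.toFun a)

theorem VSpace.norm_incr_le (a b : J) (w : VSpace s J X) : ‖VSpace.incr a b w‖ ≤ 2 * ‖w‖ := by
  rw [VSpace.incr, sub_apply, two_mul]
  exact (norm_sub_le _ _).trans (add_le_add (w.norm_eval_le a) (w.norm_eval_le b))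

/-- For `s < ∞` the variation is part of the norm and the factor `2` is superfluous; for `s = ∞` it
comes from bounding an increment by two values. -/
theorem VSpace.norm_toLp_incr_le {N : ℕ} {t : Fin (N + 1) → J} (ht : StrictMono t)
    (w : VSpace s J X) :
    ‖(WithLp.toLp s fun i : Fin N => ‖VSpace.incr (t i.succ) (t i.castSucc) w‖ :
      PiLp s fun _ : Fin N => ℝ)‖ ≤ 2 * ‖w‖ := by
  by_cases h : s = ∞
  · subst h
    rw [PiLp.norm_eq_ciSup]
    exact Real.iSup_le (fun i => by simpa using VSpace.norm_incr_le _ _ w) (by positivity)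
  · have hpos : 0 < s.toReal := ENNReal.toReal_pos (zero_lt_one.trans_le hs.out).ne' h
    rw [PiLp.norm_eq_sum hpos]
    have h0 : (∑ i : Fin N, ‖w.toFun (t i.succ) - w.toFun (t i.castSucc)‖ₑ ^ s.toReal) ^
        (1 / s.toReal) ≤ eVar s.toReal w.toFun :=
      le_iSup_of_le N (le_iSup_of_le t (le_iSup_of_le ht le_rfl))
    have h1 : eVar s.toReal w.toFun ≤ eVarNorm s w.toFun := by
      unfold eVarNorm
      rw [if_neg h]
      exact le_add_self
    have h2 := ENNReal.toReal_mono w.2.2.ne (h0.trans h1)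
    rw [← ENNReal.toReal_rpow, ENNReal.toReal_sum fun i _ => by simp [hpos.le]] at h2
    simp only [← ENNReal.toReal_rpow, toReal_enorm] at h2
    calc _ = (∑ i : Fin N, ‖w.toFun (t i.succ) - w.toFun (t i.castSucc)‖ ^ s.toReal) ^
        (1 / s.toReal) := by simp only [norm_norm]; rfl
      _ ≤ ‖w‖ := h2
      _ ≤ _ := by linarith [norm_nonneg w]

/-- Holomorphic majorants for all increments of a `C₀` function with values in `V^s(J;X)`, whose
values to the right of `b` are controlled in `ℓ^s`. -/
theorem exists_majorants (w : ZeroAtInftyContinuousMap ℝ (VSpace s J X)) {r : ℝ} (hr : 0 < r)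
    (hw : ‖w‖ ≤ r) {N : ℕ} {t : Fin (N + 1) → J} (ht : StrictMono t) {b : ℝ} (hb : 0 < b) :
    ∃ (H : Fin N → ℂ → ℂ) (A : Fin N → ℝ) (ε M : ℝ), 0 < ε ∧
      (∀ i z, 0 ≤ z.re → DifferentiableAt ℂ (H i) z ∧ ε ≤ (H i z).re ∧ ‖H i z‖ ≤ M) ∧
      (∀ i (y : ℝ), Real.exp (-y ^ 2) * ‖VSpace.incr (t i.succ) (t i.castSucc) (w y)‖ ≤
        ‖H i (y * Complex.I)‖) ∧
      (∀ i, ‖H i b‖ ≤ A i) ∧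
      ‖(WithLp.toLp s A : PiLp s fun _ : Fin N => ℝ)‖ ≤ (1 + 72 / b) * r := by
  set o : PiLp s fun _ : Fin N => ℝ := WithLp.toLp s fun _ => 1
  -- The constant vector `2η` must have `ℓ^s` norm at most `r`. Thus `η` and the nodes depend on
  -- `N`, but the bound `36` on the weights does not; `72` is `36` times the `2` of the increment
  -- bound.
  set η : ℝ := r / (2 * (‖o‖ + 1)) with hηdef
  have hη : 0 < η := by positivity
  obtain ⟨δ, S, c, hδ, hc, hsum, hv⟩ := exists_nodes w hη
  let p : Fin N → VSpace s J X → ℝ := fun i x => ‖VSpace.incr (t i.succ) (t i.castSucc) x‖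
  have hp0 : ∀ i x, 0 ≤ p i x := fun i x => norm_nonneg _
  have hp1 : ∀ i x, p i x ≤ 2 * ‖x‖ := fun i x => VSpace.norm_incr_le _ _ x
  have hp2 : ∀ i x y, p i x ≤ p i y + 2 * ‖x - y‖ := fun i x y => by
    have h1 := VSpace.norm_incr_le (t i.succ) (t i.castSucc) (x - y)
    rw [map_sub] at h1
    exact (norm_le_norm_add_norm_sub' _ _).trans (add_le_add le_rfl h1)
  have ha : ∀ i s, 0 ≤ c s * p i (w s) := fun i s => mul_nonneg (hc s) (hp0 _ _)
  refine ⟨fun i => cauchySum (2 * η) δ S fun s => c s * p i (w s),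
    fun i => 2 * η + b⁻¹ * ∑ s ∈ S, c s * p i (w s), 2 * η,
    2 * η + δ⁻¹ * ∑ s ∈ S, c s * (2 * ‖w s‖), by positivity, fun i z hz => ⟨?_, ?_, ?_⟩,
    fun i y => ?_, fun i => ?_, ?_⟩
  · exact cauchySum_differentiableAt hδ hz
  · exact le_cauchySum_re hδ (ha i) hz
  · refine (norm_cauchySum_le (by positivity) (ha i) hδ (by linarith)).trans ?_
    gcongr with s _
    · exact hc s
    · exact hp1 _ _
  · exact gaussian_mul_le_cauchySum hδ hc hv (hp0 i) (hp1 i) (hp2 i) y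
  · exact norm_cauchySum_le (by positivity) (ha i) hb (by simp [hδ.le])
  · have hA : (WithLp.toLp s (fun i => 2 * η + b⁻¹ * ∑ s ∈ S, c s * p i (w s)) :
        PiLp s fun _ : Fin N => ℝ) = (2 * η) • o + b⁻¹ • ∑ y ∈ S, c y •
          (WithLp.toLp s (fun i => p i (w y)) : PiLp s fun _ : Fin N => ℝ) := by
      ext i
      simp [o, Finset.sum_apply]
    have h1 : ‖(2 * η) • o‖ ≤ r := by
      rw [norm_smul, Real.norm_of_nonneg (by positivity), hηdef]
      have : 2 * (r / (2 * (‖o‖ + 1))) * ‖o‖ = r * (‖o‖ / (‖o‖ + 1)) := by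
        field_simp
      rw [this]
      exact mul_le_of_le_one_right hr.le ((div_le_one (by positivity)).2 (by linarith))
    have h2 : ‖∑ y ∈ S, c y •
        (WithLp.toLp s (fun i => p i (w y)) : PiLp s fun _ : Fin N => ℝ)‖ ≤ 36 * (2 * r) := by
      refine (norm_sum_le _ _).trans ?_
      calc _ ≤ ∑ y ∈ S, c y * (2 * r) := by
            refine Finset.sum_le_sum fun y _ => ?_
            rw [norm_smul, Real.norm_of_nonneg (hc y)]
            refine mul_le_mul_of_nonneg_left ?_ (hc y)
            exact (VSpace.norm_toLp_incr_le ht (w y)).trans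
              (by linarith [zeroAtInfty_norm_apply_le w y])
        _ = (∑ y ∈ S, c y) * (2 * r) := (Finset.sum_mul _ _ _).symm
        _ ≤ _ := by gcongr
    rw [hA]
    calc _ ≤ r + b⁻¹ * (36 * (2 * r)) := by
          refine (norm_add_le _ _).trans (add_le_add h1 ?_)
          rw [norm_smul, Real.norm_of_nonneg (by positivity)]
          gcongr
      _ = _ := by ring

end Increments

/-! ## A Hölder inequality -/

section Holder

/-- Lets Hölder's inequality treat finite and infinite exponents alike: for `s < ∞` take `x i = (A i
/ R)^s`, with equality in the last claim. -/
theorem exists_dominating_of_norm_toLp_le {s : ℝ≥0∞} [hs : Fact (1 ≤ s)] {N : ℕ} {A : Fin N → ℝ}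
    (hA0 : ∀ i, 0 ≤ A i) {R : ℝ} (hR : 0 < R)
    (hA : ‖(WithLp.toLp s A : PiLp s fun _ : Fin N => ℝ)‖ ≤ R) :
    ∃ x : Fin N → ℝ, (∀ i, 0 ≤ x i) ∧ ∑ i, x i ≤ 1 ∧
      ∀ i, ∀ q : ℝ, 0 ≤ q → (A i / R) ^ q ≤ x i ^ (q * (s⁻¹).toReal) := by
  by_cases h : s = ∞
  · refine ⟨0, fun _ => le_rfl, by simp, fun i q hq => ?_⟩
    have h1 : A i ≤ R := (le_abs_self _).trans ((PiLp.norm_apply_le _ i).trans hA)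
    simpa [h] using Real.rpow_le_one (div_nonneg (hA0 i) hR.le) ((div_le_one hR).2 h1) hq
  · have hpos : 0 < s.toReal := ENNReal.toReal_pos (zero_lt_one.trans_le hs.out).ne' h
    refine ⟨fun i => (A i / R) ^ s.toReal, fun i => by have := hA0 i; positivity, ?_,
      fun i q hq => ?_⟩
    · rw [PiLp.norm_eq_sum hpos, one_div, Real.rpow_inv_le_iff_of_pos
        (Finset.sum_nonneg fun i _ => by positivity) hR.le hpos] at hA
      simp only [Real.norm_of_nonneg (hA0 _)] at hA
      simp only [Real.div_rpow (hA0 _) hR.le]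
      rw [← Finset.sum_div]
      exact (div_le_one (by positivity)).2 hA
    · rw [← Real.rpow_mul (div_nonneg (hA0 i) hR.le), ENNReal.toReal_inv]
      refine le_of_eq ?_
      congr 1
      field_simp

/-- Weighted AM-GM in each term, with weights `(1-θ)p/s₀` and `θp/s₁`; these add up to `1` exactly
by the relation between the exponents. -/
theorem sum_rpow_le_of_norm_toLp_le {s₀ s₁ : ℝ≥0∞} [Fact (1 ≤ s₀)] [Fact (1 ≤ s₁)] {θ p : ℝ}
    (hθ0 : 0 ≤ θ) (hθ1 : θ ≤ 1) (hp : 0 < p)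
    (hpθ : p⁻¹ = (1 - θ) * (s₀⁻¹).toReal + θ * (s₁⁻¹).toReal)
    {N : ℕ} {A B : Fin N → ℝ} (hA0 : ∀ i, 0 ≤ A i) (hB0 : ∀ i, 0 ≤ B i) {R : ℝ} (hR : 0 < R)
    (hA : ‖(WithLp.toLp s₀ A : PiLp s₀ fun _ : Fin N => ℝ)‖ ≤ R)
    (hB : ‖(WithLp.toLp s₁ B : PiLp s₁ fun _ : Fin N => ℝ)‖ ≤ R) :
    ∑ i, (A i ^ (1 - θ) * B i ^ θ) ^ p ≤ R ^ p := by
  obtain ⟨x, hx0, hx, hAx⟩ := exists_dominating_of_norm_toLp_le hA0 hR hA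
  obtain ⟨y, hy0, hy, hBy⟩ := exists_dominating_of_norm_toLp_le hB0 hR hB
  have h1θ : 0 ≤ 1 - θ := sub_nonneg.2 hθ1
  set l := (1 - θ) * p * (s₀⁻¹).toReal
  set m := θ * p * (s₁⁻¹).toReal
  have hl : 0 ≤ l := by positivity
  have hm : 0 ≤ m := by positivity
  have hlm : l + m = 1 := by
    have : l + m = p * p⁻¹ := by rw [hpθ]; simp only [l, m]; ring
    rw [this, mul_inv_cancel₀ hp.ne']
  have hterm : ∀ i, (A i ^ (1 - θ) * B i ^ θ) ^ p ≤ R ^ p * (l * x i + m * y i) := by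
    intro i
    have ha : 0 ≤ A i / R := div_nonneg (hA0 i) hR.le
    have hb : 0 ≤ B i / R := div_nonneg (hB0 i) hR.le
    have e : (A i ^ (1 - θ) * B i ^ θ) ^ p =
        R ^ p * ((A i / R) ^ ((1 - θ) * p) * (B i / R) ^ (θ * p)) := by
      have eA : A i = R * (A i / R) := by field_simp
      have eB : B i = R * (B i / R) := by field_simp
      conv_lhs => rw [eA, eB]
      rw [Real.mul_rpow hR.le ha, Real.mul_rpow hR.le hb, mul_mul_mul_comm, ← Real.rpow_add hR,
        sub_add_cancel, Real.rpow_one, Real.mul_rpow hR.le (by positivity),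
        Real.mul_rpow (by positivity) (by positivity), ← Real.rpow_mul ha, ← Real.rpow_mul hb]
    rw [e]
    refine mul_le_mul_of_nonneg_left ?_ (by positivity)
    calc _ ≤ x i ^ l * y i ^ m :=
          mul_le_mul (hAx i _ (by positivity)) (hBy i _ (by positivity)) (by positivity)
            (Real.rpow_nonneg (hx0 i) _)
      _ ≤ _ := Real.geom_mean_le_arith_mean2_weighted hl hm (hx0 i) (hy0 i) hlm
  calc _ ≤ ∑ i, R ^ p * (l * x i + m * y i) := Finset.sum_le_sum fun i _ => hterm i
    _ = R ^ p * (l * ∑ i, x i + m * ∑ i, y i) := by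
        rw [← Finset.mul_sum, Finset.sum_add_distrib, ← Finset.mul_sum, ← Finset.mul_sum]
    _ ≤ R ^ p * 1 := by
        gcongr
        nlinarith
    _ = _ := mul_one _

end Holder

theorem eVarNorm_mono_of_norm_le {s : ℝ≥0∞} {J : Set ℝ} {X Y : Type*} [NormedAddCommGroup X]
    [NormedAddCommGroup Y] {g : J → X} {h : J → Y} (h1 : ∀ t, ‖g t‖ ≤ ‖h t‖)
    (h2 : ∀ a b, ‖g a - g b‖ ≤ ‖h a - h b‖) : eVarNorm s g ≤ eVarNorm s h := by
  unfold eVarNorm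
  refine add_le_add (iSup_mono fun t => enorm_le_iff_norm_le.2 (h1 t)) ?_
  split_ifs
  · exact le_rfl
  · unfold eVar
    gcongr with N t ht i
    · exact enorm_le_iff_norm_le.2 (h2 _ _)

/-! ## Interpolation of spaces of bounded variation -/

section Main

/-! ### Operators induced on interpolation spaces -/

section Maps

variable {X₀ X₁ V W₀ W₁ U : Type*} [NormedAddCommGroup X₀] [NormedSpace ℂ X₀]
  [NormedAddCommGroup X₁] [NormedSpace ℂ X₁]
  [AddCommGroup V] [Module ℂ V] [TopologicalSpace V] [IsTopologicalAddGroup V] [T2Space V]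
  {ι₀ : X₀ →L[ℂ] V} {ι₁ : X₁ →L[ℂ] V}
  [NormedAddCommGroup W₀] [NormedSpace ℂ W₀]
  [NormedAddCommGroup W₁] [NormedSpace ℂ W₁]
  [AddCommGroup U] [Module ℂ U] [TopologicalSpace U] [IsTopologicalAddGroup U] [T2Space U]
  {κ₀ : W₀ →L[ℂ] U} {κ₁ : W₁ →L[ℂ] U} {θ : Set.Icc (0 : ℝ) 1}

theorem Interp.exists_map (D₀ : W₀ →L[ℂ] X₀) (D₁ : W₁ →L[ℂ] X₁) (T : U →ₗ[ℂ] V)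
    (h₀ : ∀ w, T (κ₀ w) = ι₀ (D₀ w)) (h₁ : ∀ w, T (κ₁ w) = ι₁ (D₁ w)) (f : Interp κ₀ κ₁ θ) :
    ∃ x : Interp ι₀ ι₁ θ, Interp.incl ι₀ ι₁ θ x = T (Interp.incl κ₀ κ₁ θ f) := by
  obtain ⟨P, hP₀, hP₁, hP⟩ := SumSpace.exists_map D₀ D₁ T h₀ h₁
  obtain ⟨F, g₀, g₁, hF, hf⟩ := f.2
  exact ⟨⟨P (F ((θ : ℝ) : ℂ)), _, _, _, hF.map P hP₀ hP₁, rfl⟩,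
    (hP _).trans (congrArg (fun q => T (SumSpace.incl κ₀ κ₁ q)) hf)⟩

/-- Here `x` is fixed beforehand and identified by its image in `V`, so the same `x` can be
estimated through every admissible representative of `f`. This is what allows passing to the
infimum. -/
theorem Admissible.exists_map {F : ℂ → SumSpace κ₀ κ₁} {g₀ g₁} (hF : Admissible κ₀ κ₁ F g₀ g₁)
    {f : Interp κ₀ κ₁ θ} (hf : F ((θ : ℝ) : ℂ) = Interp.toSum κ₀ κ₁ θ f)
    (D₀ : W₀ →L[ℂ] X₀) (D₁ : W₁ →L[ℂ] X₁) (T : U →ₗ[ℂ] V)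
    (h₀ : ∀ w, T (κ₀ w) = ι₀ (D₀ w)) (h₁ : ∀ w, T (κ₁ w) = ι₁ (D₁ w))
    {x : Interp ι₀ ι₁ θ} (hx : Interp.incl ι₀ ι₁ θ x = T (Interp.incl κ₀ κ₁ θ f)) :
    ∃ G, Admissible ι₀ ι₁ G (zeroAtInftyMap D₀ g₀) (zeroAtInftyMap D₁ g₁) ∧
      G ((θ : ℝ) : ℂ) = Interp.toSum ι₀ ι₁ θ x := by
  obtain ⟨P, hP₀, hP₁, hP⟩ := SumSpace.exists_map D₀ D₁ T h₀ h₁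
  refine ⟨_, hF.map P hP₀ hP₁, SumSpace.incl_injective ?_⟩
  rw [hP, hf]
  exact hx.symm

end Maps

variable {X₀ X₁ V : Type*} [NormedAddCommGroup X₀] [NormedSpace ℂ X₀]
  [NormedAddCommGroup X₁] [NormedSpace ℂ X₁]
  [AddCommGroup V] [Module ℂ V] [TopologicalSpace V] [IsTopologicalAddGroup V] [T2Space V]
  {ι₀ : X₀ →L[ℂ] V} {ι₁ : X₁ →L[ℂ] V} {J : Set ℝ} {θ : Set.Icc (0 : ℝ) 1}
  {s₀ s₁ sθ : ℝ≥0∞} [Fact (1 ≤ s₀)] [Fact (1 ≤ s₁)]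
  {F : ℂ → SumSpace (VSpace.incl s₀ J ι₀) (VSpace.incl s₁ J ι₁)}
  {g₀ : ZeroAtInftyContinuousMap ℝ (VSpace s₀ J X₀)}
  {g₁ : ZeroAtInftyContinuousMap ℝ (VSpace s₁ J X₁)}
  {f : Interp (VSpace.incl s₀ J ι₀) (VSpace.incl s₁ J ι₁) θ} {g : J → Interp ι₀ ι₁ θ}

/-! ### Values and increments of the interpolated function -/

theorem exists_pointwise (f : Interp (VSpace.incl s₀ J ι₀) (VSpace.incl s₁ J ι₁) θ) :
    ∃ g : J → Interp ι₀ ι₁ θ, ∀ t, Interp.incl ι₀ ι₁ θ (g t) =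
      Interp.incl (VSpace.incl s₀ J ι₀) (VSpace.incl s₁ J ι₁) θ f t := by
  choose g hg using fun t : J => Interp.exists_map (ι₀ := ι₀) (ι₁ := ι₁)
    (VSpace.eval s₀ J X₀ t) (VSpace.eval s₁ J X₁ t) (LinearMap.proj t)
    (fun _ => rfl) (fun _ => rfl) f
  exact ⟨g, hg⟩

theorem Admissible.exists_eval (hF : Admissible _ _ F g₀ g₁)
    (hf : F ((θ : ℝ) : ℂ) = Interp.toSum _ _ θ f)
    (hg : ∀ t, Interp.incl ι₀ ι₁ θ (g t) =
      Interp.incl (VSpace.incl s₀ J ι₀) (VSpace.incl s₁ J ι₁) θ f t) (t : J) :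
    ∃ G, Admissible ι₀ ι₁ G (zeroAtInftyMap (VSpace.eval s₀ J X₀ t) g₀)
        (zeroAtInftyMap (VSpace.eval s₁ J X₁ t) g₁) ∧
      G ((θ : ℝ) : ℂ) = Interp.toSum ι₀ ι₁ θ (g t) :=
  hF.exists_map hf _ _ (LinearMap.proj t) (fun _ => rfl) (fun _ => rfl) (hg t)

theorem Admissible.exists_incr (hF : Admissible _ _ F g₀ g₁)
    (hf : F ((θ : ℝ) : ℂ) = Interp.toSum _ _ θ f)
    (hg : ∀ t, Interp.incl ι₀ ι₁ θ (g t) =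
      Interp.incl (VSpace.incl s₀ J ι₀) (VSpace.incl s₁ J ι₁) θ f t) (a b : J) :
    ∃ G, Admissible ι₀ ι₁ G (zeroAtInftyMap (VSpace.incr a b) g₀)
        (zeroAtInftyMap (VSpace.incr a b) g₁) ∧
      G ((θ : ℝ) : ℂ) = Interp.toSum ι₀ ι₁ θ (g a - g b) := by
  let T : (J → V) →ₗ[ℂ] V :=
    LinearMap.proj (R := ℂ) (φ := fun _ => V) a - LinearMap.proj (φ := fun _ => V) b
  have hT : ∀ u : J → V, T u = u a - u b := fun _ => rfl
  refine hF.exists_map hf _ _ T (fun _ => (map_sub ι₀ _ _).symm)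
    (fun _ => (map_sub ι₁ _ _).symm) ?_
  rw [map_sub, hg, hg, hT]

theorem norm_pointwise_le (hF : Admissible _ _ F g₀ g₁)
    (hf : F ((θ : ℝ) : ℂ) = Interp.toSum _ _ θ f)
    (hg : ∀ t, Interp.incl ι₀ ι₁ θ (g t) =
      Interp.incl (VSpace.incl s₀ J ι₀) (VSpace.incl s₁ J ι₁) θ f t) (t : J) :
    ‖g t‖ ≤ max ‖g₀‖ ‖g₁‖ := by
  obtain ⟨G, hG, hGθ⟩ := hF.exists_eval hf hg t
  refine (Interp.norm_le ι₀ ι₁ θ hG hGθ).trans (max_le_max ?_ ?_)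
  · exact zeroAtInfty_norm_le (norm_nonneg _) fun y =>
      (VSpace.norm_eval_le _ _).trans (zeroAtInfty_norm_apply_le _ _)
  · exact zeroAtInfty_norm_le (norm_nonneg _) fun y =>
      (VSpace.norm_eval_le _ _).trans (zeroAtInfty_norm_apply_le _ _)

/-! ### Strong measurability when `s₀ = s₁ = ∞` -/

/-- A `C₀` function with values in `V^∞(J;X)` has uniformly small increments on the sets of some
countable measurable partition of `J`. -/
theorem exists_label_incr {X : Type*} [NormedAddCommGroup X] [NormedSpace ℂ X]
    {s : ℝ≥0∞} [Fact (1 ≤ s)] (hs : s = ∞) (w : ZeroAtInftyContinuousMap ℝ (VSpace s J X))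
    {ε : ℝ} (hε : 0 < ε) :
    ∃ (ι : Type) (_ : Countable ι) (n : J → ι), (∀ i, MeasurableSet (n ⁻¹' {i})) ∧
      ∀ a b, n a = n b → ‖zeroAtInftyMap (VSpace.incr a b) w‖ ≤ 3 * ε := by
  obtain ⟨_, S, _, _, _, _, hv⟩ := exists_nodes w hε
  choose n hn hnd using fun y : ℝ => exists_measurable_label ((w y).2.1 hs) hε
  -- Up to `ε`, `w` takes only the values at the finitely many nodes, so the common refinement of
  -- their partitions is still countable. Passing to a node costs `2ε` and the label costs `ε`.
  refine ⟨S → ℕ, inferInstance, fun a y => n y a, fun i => ?_, fun a b hab => ?_⟩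
  · exact measurableSet_preimage (measurable_pi_lambda _ fun y : S => hn y)
      (measurableSet_singleton i)
  · refine zeroAtInfty_norm_le (by positivity) fun y => ?_
    change ‖VSpace.incr a b (w y)‖ ≤ 3 * ε
    rcases hv y with h | ⟨x, hx, h, -⟩
    · exact (VSpace.norm_incr_le _ _ _).trans (by linarith)
    · have h1 := VSpace.norm_incr_le a b (w y - w x)
      have h2 : ‖VSpace.incr a b (w x)‖ < ε := by
        have := hnd x a b (congrFun hab ⟨x, hx⟩)
        rwa [dist_eq_norm] at this
      rw [map_sub] at h1
      linarith [norm_le_norm_add_norm_sub' (VSpace.incr a b (w y)) (VSpace.incr a b (w x))]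

/-- The increments of `g` are bounded by the larger of the two boundary increments, which are small
on the common refinement of the partitions for `g₀` and `g₁`. -/
theorem stronglyMeasurable_pointwise (h₀ : s₀ = ∞) (h₁ : s₁ = ∞) (hF : Admissible _ _ F g₀ g₁)
    (hf : F ((θ : ℝ) : ℂ) = Interp.toSum _ _ θ f)
    (hg : ∀ t, Interp.incl ι₀ ι₁ θ (g t) =
      Interp.incl (VSpace.incl s₀ J ι₀) (VSpace.incl s₁ J ι₁) θ f t) :
    StronglyMeasurable g := by
  refine stronglyMeasurable_of_label fun ε hε => ?_
  obtain ⟨I₀, hI₀, n₀, hn₀, hd₀⟩ := exists_label_incr h₀ g₀ (ε := ε / 3) (by positivity)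
  obtain ⟨I₁, hI₁, n₁, hn₁, hd₁⟩ := exists_label_incr h₁ g₁ (ε := ε / 3) (by positivity)
  refine ⟨I₀ × I₁, inferInstance, fun a => (n₀ a, n₁ a), fun i => ?_, fun a b hab => ?_⟩
  · have : (fun a => (n₀ a, n₁ a)) ⁻¹' {i} = n₀ ⁻¹' {i.1} ∩ n₁ ⁻¹' {i.2} := by
      ext a
      simp [Prod.ext_iff]
    rw [this]
    exact (hn₀ _).inter (hn₁ _)
  · obtain ⟨G, hG, hGθ⟩ := hF.exists_incr hf hg a b
    rw [dist_eq_norm]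
    refine (Interp.norm_le ι₀ ι₁ θ hG hGθ).trans (max_le ?_ ?_)
    · linarith [hd₀ a b (congrArg Prod.fst hab)]
    · linarith [hd₁ a b (congrArg Prod.snd hab)]

/-- Domination of increments, unlike that of norms, also transfers strong measurability: a partition
on which `h` oscillates little serves `g`. -/
theorem memVar_of_norm_le {X : Type*} [NormedAddCommGroup X] [NormedSpace ℂ X]
    {Y : Type*} [NormedAddCommGroup Y] {s : ℝ≥0∞} [Fact (1 ≤ s)] {g : J → Y} {h : VSpace s J X}
    (h1 : ∀ t, ‖g t‖ ≤ ‖h.toFun t‖) (h2 : ∀ a b, ‖g a - g b‖ ≤ ‖h.toFun a - h.toFun b‖) :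
    MemVar s g ∧ eVarNorm s g ≤ ENNReal.ofReal ‖h‖ := by
  have hle : eVarNorm s g ≤ eVarNorm s h.toFun := eVarNorm_mono_of_norm_le h1 h2
  refine ⟨⟨fun hs => ?_, hle.trans_lt h.2.2⟩, hle.trans_eq (ENNReal.ofReal_toReal h.2.2.ne).symm⟩
  refine stronglyMeasurable_of_label fun ε hε => ?_
  obtain ⟨n, hn, hnd⟩ := exists_measurable_label (h.2.1 hs) hε
  refine ⟨ℕ, inferInstance, n, fun i => hn (measurableSet_singleton i), fun a b hab => ?_⟩
  have := hnd a b hab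
  rw [dist_eq_norm] at this ⊢
  exact (h2 a b).trans this.le

/-! ### The endpoints `θ = 0` and `θ = 1` -/

theorem memVar_of_eq_zero (hF : Admissible _ _ F g₀ g₁)
    (hf : F ((θ : ℝ) : ℂ) = Interp.toSum _ _ θ f)
    (hg : ∀ t, Interp.incl ι₀ ι₁ θ (g t) =
      Interp.incl (VSpace.incl s₀ J ι₀) (VSpace.incl s₁ J ι₁) θ f t) (hθ : (θ : ℝ) = 0) :
    MemVar s₀ g ∧ eVarNorm s₀ g ≤ ENNReal.ofReal (max ‖g₀‖ ‖g₁‖) := by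
  have := memVar_of_norm_le (g := g) (h := g₀ 0) (fun t => ?_) fun a b => ?_
  · exact ⟨this.1, this.2.trans (ENNReal.ofReal_le_ofReal
      ((zeroAtInfty_norm_apply_le _ _).trans (le_max_left _ _)))⟩
  · obtain ⟨G, hG, hGθ⟩ := hF.exists_eval hf hg t
    exact hG.norm_le_of_eq_zero hθ hGθ
  · obtain ⟨G, hG, hGθ⟩ := hF.exists_incr hf hg a b
    exact hG.norm_le_of_eq_zero hθ hGθ

theorem memVar_of_eq_one (hF : Admissible _ _ F g₀ g₁)
    (hf : F ((θ : ℝ) : ℂ) = Interp.toSum _ _ θ f)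
    (hg : ∀ t, Interp.incl ι₀ ι₁ θ (g t) =
      Interp.incl (VSpace.incl s₀ J ι₀) (VSpace.incl s₁ J ι₁) θ f t) (hθ : (θ : ℝ) = 1) :
    MemVar s₁ g ∧ eVarNorm s₁ g ≤ ENNReal.ofReal (max ‖g₀‖ ‖g₁‖) := by
  have := memVar_of_norm_le (g := g) (h := g₁ 0) (fun t => ?_) fun a b => ?_
  · exact ⟨this.1, this.2.trans (ENNReal.ofReal_le_ofReal
      ((zeroAtInfty_norm_apply_le _ _).trans (le_max_right _ _)))⟩
  · obtain ⟨G, hG, hGθ⟩ := hF.exists_eval hf hg t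
    exact hG.norm_le_of_eq_one hθ hGθ
  · obtain ⟨G, hG, hGθ⟩ := hF.exists_incr hf hg a b
    exact hG.norm_le_of_eq_one hθ hGθ

/-! ### The variation estimate for `0 < θ < 1` and the conclusion -/

/-- The constant in the variation estimate. -/
noncomputable def varConst (θ : ℝ) : ℝ :=
  Real.exp (2 + Real.pi ^ 2) * (1 + 72 / θ + 72 / (1 - θ))

theorem varConst_nonneg (θ : Set.Icc (0 : ℝ) 1) : 0 ≤ varConst θ := by
  have h0 := θ.2.1
  have h1 := sub_nonneg.2 θ.2.2
  unfold varConst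
  -- At `θ = 0` or `1` one quotient is a division by zero with value `0`; only nonnegativity is
  -- needed there.
  positivity

theorem eVar_pointwise_le (hF : Admissible _ _ F g₀ g₁)
    (hf : F ((θ : ℝ) : ℂ) = Interp.toSum _ _ θ f)
    (hg : ∀ t, Interp.incl ι₀ ι₁ θ (g t) =
      Interp.incl (VSpace.incl s₀ J ι₀) (VSpace.incl s₁ J ι₁) θ f t)
    (hθ0 : 0 < (θ : ℝ)) (hθ1 : (θ : ℝ) < 1) {p : ℝ} (hp : 0 < p)
    (hpθ : p⁻¹ = (1 - (θ : ℝ)) * (s₀⁻¹).toReal + θ * (s₁⁻¹).toReal)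
    {r : ℝ} (hr : 0 < r) (hr₀ : ‖g₀‖ ≤ r) (hr₁ : ‖g₁‖ ≤ r) :
    eVar p g ≤ ENNReal.ofReal (varConst θ * r) := by
  refine iSup_le fun N => iSup_le fun t => iSup_le fun ht => ?_
  have h1θ : 0 < 1 - (θ : ℝ) := sub_pos.2 hθ1
  -- The majorants live on the right half-plane, so the line `Re z = 1` is brought to the imaginary
  -- axis by `z ↦ 1 - z`. This sends `1 + iy` to `-iy` and `θ` to `1 - θ`.
  let g₁' : ZeroAtInftyContinuousMap ℝ (VSpace s₁ J X₁) :=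
    { toFun := fun y => g₁ (-y)
      continuous_toFun := (map_continuous g₁).comp continuous_neg
      zero_at_infty' := g₁.zero_at_infty'.comp
        (Homeomorph.neg ℝ).isClosedEmbedding.tendsto_cocompact }
  have hr₁' : ‖g₁'‖ ≤ r := zeroAtInfty_norm_le hr.le fun y =>
    (zeroAtInfty_norm_apply_le g₁ (-y)).trans hr₁
  obtain ⟨H₀, A, ε₀, M₀, hε₀, hH₀, hb₀, hA, hAn⟩ := exists_majorants g₀ hr hr₀ ht hθ0
  obtain ⟨H₁, B, ε₁, M₁, hε₁, hH₁, hb₁, hB, hBn⟩ := exists_majorants g₁' hr hr₁' ht h1θ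
  have hA0 : ∀ i, 0 ≤ A i := fun i => (norm_nonneg _).trans (hA i)
  have hB0 : ∀ i, 0 ≤ B i := fun i => (norm_nonneg _).trans (hB i)
  set K := Real.exp (2 + Real.pi ^ 2)
  have hincr : ∀ i : Fin N, ‖g (t i.succ) - g (t i.castSucc)‖ ≤
      K * (A i ^ (1 - (θ : ℝ)) * B i ^ (θ : ℝ)) := by
    intro i
    obtain ⟨G, hG, hGθ⟩ := hF.exists_incr hf hg (t i.succ) (t i.castSucc)
    have hre : ∀ z ∈ verticalClosedStrip 0 1, 0 ≤ (1 - z).re := fun z hz => by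
      simpa using hz.2
    have key := hG.norm_le_mul_rpow hGθ (H₀ := H₀ i) (H₁ := fun z => H₁ i (1 - z))
      (ε := min ε₀ ε₁) (M := max M₀ M₁) (lt_min hε₀ hε₁)
      (fun z hz => (hH₀ i z hz.1).1)
      (fun z hz => (hH₁ i _ (hre z hz)).1.comp z (by fun_prop))
      (fun z hz => (min_le_left _ _).trans (hH₀ i z hz.1).2.1)
      (fun z hz => (min_le_right _ _).trans (hH₁ i _ (hre z hz)).2.1)
      (fun z hz => (hH₀ i z hz.1).2.2.trans (le_max_left _ _))
      (fun z hz => (hH₁ i _ (hre z hz)).2.2.trans (le_max_right _ _))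
      (fun y => hb₀ i y) (fun y => ?_)
    · refine key.trans ?_
      have hB' : ‖H₁ i (1 - ((θ : ℝ) : ℂ))‖ ≤ B i := by
        have := hB i
        push_cast at this
        exact this
      gcongr
      · exact Real.rpow_nonneg (hA0 i) _
      · exact hA i
    · have h1 : (1 : ℂ) - (1 + y * Complex.I) = ((-y : ℝ) : ℂ) * Complex.I := by
        push_cast
        ring
      have h2 := hb₁ i (-y)
      rw [neg_sq] at h2
      rw [h1]
      refine le_trans (le_of_eq ?_) h2
      change _ * ‖VSpace.incr _ _ (g₁ y)‖ = _ * ‖VSpace.incr _ _ (g₁ (- -y))‖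
      rw [neg_neg]
  -- A common bound for the `ℓ^{s₀}` norm of `A` and the `ℓ^{s₁}` norm of `B`.
  set R := (1 + 72 / (θ : ℝ) + 72 / (1 - (θ : ℝ))) * r with hRdef
  have hR : 0 < R := by positivity
  have hsum := sum_rpow_le_of_norm_toLp_le hθ0.le hθ1.le hp hpθ hA0 hB0 hR
    (hAn.trans (by
      rw [hRdef]
      refine mul_le_mul_of_nonneg_right ?_ hr.le
      linarith [div_nonneg (by norm_num : (0 : ℝ) ≤ 72) hθ0.le,
        div_nonneg (by norm_num : (0 : ℝ) ≤ 72) h1θ.le]))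
    (hBn.trans (by
      rw [hRdef]
      refine mul_le_mul_of_nonneg_right ?_ hr.le
      linarith [div_nonneg (by norm_num : (0 : ℝ) ≤ 72) hθ0.le,
        div_nonneg (by norm_num : (0 : ℝ) ≤ 72) h1θ.le]))
  have hK : 0 < K := Real.exp_pos _
  have hfin : ∑ i : Fin N, ‖g (t i.succ) - g (t i.castSucc)‖ ^ p ≤ (K * R) ^ p := by
    calc _ ≤ ∑ i : Fin N, K ^ p * (A i ^ (1 - (θ : ℝ)) * B i ^ (θ : ℝ)) ^ p := by
          refine Finset.sum_le_sum fun i _ => ?_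
          rw [← Real.mul_rpow hK.le (mul_nonneg (Real.rpow_nonneg (hA0 i) _)
            (Real.rpow_nonneg (hB0 i) _))]
          exact Real.rpow_le_rpow (norm_nonneg _) (hincr i) hp.le
      _ ≤ K ^ p * R ^ p := by
          rw [← Finset.mul_sum]
          gcongr
      _ = _ := (Real.mul_rpow hK.le hR.le).symm
  have hKR : varConst θ * r = K * R := by
    rw [hRdef, varConst]
    ring
  rw [hKR, one_div, ENNReal.rpow_inv_le_iff hp, ENNReal.ofReal_rpow_of_nonneg (by positivity) hp.le]
  refine le_trans (le_of_eq ?_) (ENNReal.ofReal_le_ofReal hfin)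
  rw [ENNReal.ofReal_sum_of_nonneg fun i _ => by positivity]
  refine Finset.sum_congr rfl fun i _ => ?_
  rw [← ENNReal.ofReal_rpow_of_nonneg (norm_nonneg _) hp.le, ofReal_norm]

theorem eVarNorm_pointwise_le
    (hsθ : sθ⁻¹ = ENNReal.ofReal (1 - θ) / s₀ + ENNReal.ofReal θ / s₁)
    (hF : Admissible _ _ F g₀ g₁)
    (hf : F ((θ : ℝ) : ℂ) = Interp.toSum _ _ θ f)
    (hg : ∀ t, Interp.incl ι₀ ι₁ θ (g t) =
      Interp.incl (VSpace.incl s₀ J ι₀) (VSpace.incl s₁ J ι₁) θ f t)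
    {r : ℝ} (hr : max ‖g₀‖ ‖g₁‖ < r) :
    MemVar sθ g ∧ eVarNorm sθ g ≤ ENNReal.ofReal ((1 + varConst θ) * r) := by
  have hr0 : 0 < r := ((norm_nonneg _).trans (le_max_left _ _)).trans_lt hr
  have hC := varConst_nonneg θ
  have hrC : r ≤ (1 + varConst θ) * r := le_mul_of_one_le_left hr0.le (by linarith)
  rcases θ.2.1.eq_or_lt with hθ0 | hθ0
  · have hs : sθ = s₀ := by
      rw [← inv_inj, hsθ, ← hθ0]
      simp
    subst hs
    obtain ⟨h1, h2⟩ := memVar_of_eq_zero hF hf hg hθ0.symm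
    exact ⟨h1, h2.trans (ENNReal.ofReal_le_ofReal (hr.le.trans hrC))⟩
  rcases θ.2.2.eq_or_lt with hθ1 | hθ1
  · have hs : sθ = s₁ := by
      rw [← inv_inj, hsθ, hθ1]
      simp
    subst hs
    obtain ⟨h1, h2⟩ := memVar_of_eq_one hF hf hg hθ1
    exact ⟨h1, h2.trans (ENNReal.ofReal_le_ofReal (hr.le.trans hrC))⟩
  have hsup : ⨆ t, ‖g t‖ₑ ≤ ENNReal.ofReal r := iSup_le fun t => by
    rw [← ofReal_norm]
    exact ENNReal.ofReal_le_ofReal ((norm_pointwise_le hF hf hg t).trans hr.le)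
  have hle : eVarNorm sθ g ≤ ENNReal.ofReal ((1 + varConst θ) * r) := by
    rw [add_mul, one_mul, ENNReal.ofReal_add hr0.le (by positivity)]
    refine add_le_add hsup ?_
    split_ifs with h
    · exact zero_le
    · have hinv : ∀ s : ℝ≥0∞, [Fact (1 ≤ s)] → s⁻¹ ≠ ∞ := fun s hs =>
        ENNReal.inv_ne_top.2 (zero_lt_one.trans_le hs.out).ne'
      have hne : sθ ≠ 0 := by
        rintro rfl
        rw [ENNReal.inv_zero, div_eq_mul_inv, div_eq_mul_inv] at hsθ
        exact ENNReal.add_ne_top.2 ⟨ENNReal.mul_ne_top ENNReal.ofReal_ne_top (hinv s₀),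
          ENNReal.mul_ne_top ENNReal.ofReal_ne_top (hinv s₁)⟩ hsθ.symm
      refine eVar_pointwise_le hF hf hg hθ0 hθ1 (ENNReal.toReal_pos hne h) ?_ hr0
        ((le_max_left _ _).trans hr.le) ((le_max_right _ _).trans hr.le)
      rw [← ENNReal.toReal_inv, hsθ, div_eq_mul_inv, div_eq_mul_inv, ENNReal.toReal_add
        (ENNReal.mul_ne_top ENNReal.ofReal_ne_top (hinv s₀))
        (ENNReal.mul_ne_top ENNReal.ofReal_ne_top (hinv s₁)), ENNReal.toReal_mul,
        ENNReal.toReal_mul, ENNReal.toReal_ofReal (sub_nonneg.2 θ.2.2),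
        ENNReal.toReal_ofReal θ.2.1]
  refine ⟨⟨fun h => ?_, hle.trans_lt ENNReal.ofReal_lt_top⟩, hle⟩
  -- For `0 < θ < 1`, `1/s_θ = 0` forces both summands to vanish, hence `s₀ = s₁ = ∞`.
  rw [h, ENNReal.inv_top, eq_comm, add_eq_zero, ENNReal.div_eq_zero_iff,
    ENNReal.div_eq_zero_iff] at hsθ
  exact stronglyMeasurable_pointwise
    (hsθ.1.resolve_left (by simpa using hθ1)) (hsθ.2.resolve_left (by simpa using hθ0)) hF hf hg

end Main

end VarInterp

theorem lemma2p5 (θ : Set.Icc (0 : ℝ) 1) (s₀ s₁ sθ : ℝ≥0∞)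
    [Fact (1 ≤ s₀)] [Fact (1 ≤ s₁)]
    (hsθ : sθ⁻¹ = ENNReal.ofReal (1 - θ) / s₀ + ENNReal.ofReal θ / s₁) :
    ∃ C : ℝ, 0 ≤ C ∧
      ∀ (X₀ : Type u₀) [NormedAddCommGroup X₀] [NormedSpace ℂ X₀] [CompleteSpace X₀]
        (X₁ : Type u₁) [NormedAddCommGroup X₁] [NormedSpace ℂ X₁] [CompleteSpace X₁]
        (V : Type v) [AddCommGroup V] [Module ℂ V] [TopologicalSpace V]
        [IsTopologicalAddGroup V] [ContinuousSMul ℂ V] [T2Space V]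
        (ι₀ : X₀ →L[ℂ] V) (_ : Function.Injective ι₀)
        (ι₁ : X₁ →L[ℂ] V) (_ : Function.Injective ι₁) (J : Set ℝ)
        (f : Interp (VSpace.incl s₀ J ι₀) (VSpace.incl s₁ J ι₁) θ),
        ∃ g : J → Interp ι₀ ι₁ θ,
          (∀ t, Interp.incl ι₀ ι₁ θ (g t) =
            Interp.incl (VSpace.incl s₀ J ι₀) (VSpace.incl s₁ J ι₁) θ f t) ∧
          MemVar sθ g ∧ eVarNorm sθ g ≤ ENNReal.ofReal (C * ‖f‖) := by
  refine ⟨1 + varConst θ, by linarith [varConst_nonneg θ], ?_⟩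
  intro X₀ _ _ _ X₁ _ _ _ V _ _ _ _ _ _ ι₀ _ ι₁ _ J f
  obtain ⟨g, hg⟩ := exists_pointwise f
  have key : ∀ r, ‖f‖ < r →
      MemVar sθ g ∧ eVarNorm sθ g ≤ ENNReal.ofReal ((1 + varConst θ) * r) := fun r hr => by
    obtain ⟨F, g₀, g₁, hF, hf, hlt⟩ := Interp.exists_lt _ _ θ hr
    exact eVarNorm_pointwise_le hsθ hF hf hg hlt
  refine ⟨g, hg, (key (‖f‖ + 1) (lt_add_one _)).1, ?_⟩
  -- The infimum defining `‖f‖` need not be attained; since `g` does not depend on `r`, the bound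
  -- survives `r ↓ ‖f‖`.
  have hlim : Filter.Tendsto (fun r : ℝ => ENNReal.ofReal ((1 + varConst θ) * r))
      (nhdsWithin ‖f‖ (Set.Ioi ‖f‖)) (nhds (ENNReal.ofReal ((1 + varConst θ) * ‖f‖))) :=
    ((ENNReal.continuous_ofReal.comp (continuous_const.mul continuous_id)).tendsto _).mono_left
      nhdsWithin_le_nhds
  exact ge_of_tendsto hlim (Filter.eventually_of_mem self_mem_nhdsWithin fun r hr => (key r hr).2)
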